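/- Let $p$ be an odd prime, $k,j$ integers with $1\le k<p/2$ and $1\le j\le 2k-1$, and let $\mathbb{F}(p)=\mathbb{F}_p((T^{-1}))$ be the field of power series in $1/T$ over $\mathbb{F}_p$. **Notation.** Let $P_k=(T^2-1)^k$ and let $R_k$ be the remainder of the Euclidean division of $T^p$ by $P_k$ in $\mathbb{F}_p[T]$. Put $\omega_k=(-1)^{k-1}\prod_{1\le i\le k}\left(1-\frac1{2i}\right)\in\mathbb{F}_p^*$, and define $w_1,\dots,w_{2k}\in\mathbb{F}_p^*$ by $w_1=\frac{2k-1}{2k\omega_k}$ and $w_{i+1}w_i=\frac{(2k-2i-1)(2k-2i+1)}{i(2k-i)}$ for $1\le i\le 2k-1$. Let $K_{n,m}=\langle w_nT,\dots,w_mT\rangle\in\mathbb{F}_p[T]$ be the continuant, where $\langle\,\rangle=1$, $\langle x_1\rangle=x_1$, $\langle x_1,\dots,x_r\rangle=x_r\langle x_1,\dots,x_{r-1}\rangle+\langle x_1,\dots,x_{r-2}\rangle$; thus $K_{n,n-1}=1$. For $\epsilon\in\mathbb{F}_p^*$ and $V=[p,k,j,\epsilon]$ let $$H(V)(X)=K_{j+2,2k}X^{p+1}-K_{j+1,2k}X^p+\epsilon\,(K_{1,j}X+K_{1,j-1})\in\mathbb{F}_p[T][X].$$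 An infinite continued fraction $\alpha=[a_1,a_2,\dots]\in\mathbb{F}(p)$ has all its partial quotients $a_i\in\mathbb{F}_p[T]$ non-constant, and $\alpha_n=[a_n,a_{n+1},\dots]$ denotes its complete quotients. Given $\Lambda=(\lambda_1,\dots,\lambda_\ell,\epsilon_1,\epsilon_2)$ with $\ell\ge1$, $\lambda_i,\epsilon_1\in\mathbb{F}_p^*$, $\epsilon_2\in\mathbb{F}_p$, an infinite continued fraction $\alpha\in\mathbb{F}(p)$ is the $P_k$-expansion defined by $\Lambda$ if $\alpha=[\lambda_1T,\dots,\lambda_\ell T,\alpha_{\ell+1}]$ and $\alpha^p=\epsilon_1P_k\alpha_{\ell+1}+\epsilon_2R_k$. It is called perfect of type A if $\epsilon_2\ne0$ and $$[\lambda_\ell,\dots,\lambda_2,\lambda_1-\epsilon_2]=\epsilon_1/(\epsilon_2\omega_k),\qquad\mathcal{H}(A)$$ and perfect of type B if $$[\lambda_\ell,\dots,\lambda_2,\lambda_1-\epsilon_2]=0.\qquad\mathcal{H}(B)$$ For $x_1,\dots,x_n\in\mathbb{F}_p$, writing $[x_1,\dots,x_n]=x_1+1/(x_2+1/(\cdots))\in\mathbb{F}_p$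 includes the assertion that it is well defined, i.e. $x_n\neq0$, $[x_{n-1},x_n]\ne0$, ..., $[x_2,\dots,x_n]\neq0$ (no condition if $n=1$). **Proposition 5.1.** For each $V=[p,k,j,\epsilon]$ as above: 1. There is a unique infinite continued fraction $\alpha\in\mathbb{F}(p)$ with $$\alpha=[w_{j+1}T,\dots,w_{2k}T,\alpha_{2k-j+1}],\qquad \alpha^p=\epsilon(-1)^{k+j}(P_k\alpha_{2k-j+1}-R_k),$$ and a unique infinite continued fraction $\beta\in\mathbb{F}(p)$ with $$\beta=[w_{2k-j+1}T,\dots,w_{2k}T,\beta_{j+1}],\qquad \beta^p=\epsilon^{-1}(-1)^{k+j}(P_k\beta_{j+1}-R_k).$$ Both are $P_k$-expansions, and $H(V)(\alpha)=0$ and $H(V)(1/\beta)=0$. 2. The values $$\epsilon_A=(-1)^{k+j+1}[w_{j+1},\dots,w_{2k},\omega_k],\qquad \epsilon_B=(-1)^{k+j+1}[w_{j+1},\dots,w_{2k}]$$ are well defined, non-zero and different. If $\epsilon=\epsilon_A$, then $\alpha$ and $\beta$ are both perfect of type A. If $\epsilon=\epsilon_B$, then $\alpha$ and $\beta$ are both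 perfect of type B. 3. If $k=(p-1)/2$ and $\epsilon=\epsilon_A$, then $\alpha=(-1)^j\rho$, where $\rho=[-2T,2T,-2T,2T,\dots]$, and $\alpha$ is a root of the polynomial $X^2+2(-1)^jTX+1$, which divides $H(V)$ in $\mathbb{F}_p[T][X]$. -/

import Mathlib

open scoped Polynomial LaurentSeries

namespace PkCF

noncomputable section

/-! ### Continued fractions in the field of power series in `1/T`

The field `F((1/T))` is the field of Laurent series over `F`, the Laurent series variable being
`1/T`.  So the coefficient of `T ^ i` in `α` is `α.coeff (-i)`. -/

section Series

variable {F : Type*} [Field F]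

/-- The embedding `F[T] → F((1/T))`: constants go to constants, and `T` goes to the inverse of
the Laurent series variable. -/
def polyEmb : F[X] →+* F⸨X⸩ :=
  Polynomial.eval₂RingHom (HahnSeries.C : F →+* F⸨X⸩) (HahnSeries.single (-1 : ℤ) (1 : F))

/-- The integral (i.e. polynomial) part of `α`: the sum of the terms `u_i T ^ i` with `0 ≤ i`. -/
def polyPart (α : F⸨X⸩) : F[X] :=
  ∑ i ∈ Finset.range ((-α.order).toNat + 1), Polynomial.monomial i (α.coeff (-(i : ℤ)))

/-- `completeQuotient α n` is the complete quotient `α_{n+1}` of the continued fraction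
expansion of `α`; in particular `completeQuotient α 0 = α`. -/
def completeQuotient (α : F⸨X⸩) : ℕ → F⸨X⸩
  | 0 => α
  | n + 1 => (completeQuotient α n - polyEmb (polyPart (completeQuotient α n)))⁻¹

/-- `partialQuotient α n` is the partial quotient `a_{n+1}` of the continued fraction expansion
`α = [a_1, a_2, ...]`. -/
def partialQuotient (α : F⸨X⸩) (n : ℕ) : F[X] := polyPart (completeQuotient α n)

/-- `α` is an infinite continued fraction: the expansion never stops, and all partial quotients
(the first one included) are non-constant polynomials. -/
def IsInfiniteCF (α : F⸨X⸩) : Prop :=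
  ∀ n, completeQuotient α n ≠ polyEmb (partialQuotient α n) ∧
    0 < (partialQuotient α n).natDegree

/-- The value of the finite continued fraction `[x_1, ..., x_n] = x_1 + 1/(x_2 + 1/(...))` with
constant entries.  (With `0⁻¹ = 0`, the last step gives `[x_n] = x_n`.) -/
def finCF : List F → F
  | [] => 0
  | x :: l => x + (finCF l)⁻¹

/-- The quantity `[x_1, ..., x_n]` with `n ≥ 1` is well defined:
`[x_n] ≠ 0`, `[x_{n-1}, x_n] ≠ 0`, ..., `[x_2, ..., x_n] ≠ 0`. -/
def FinCFDefined : List F → Prop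
  | [] => False
  | [_] => True
  | _ :: y :: l => FinCFDefined (y :: l) ∧ finCF (y :: l) ≠ 0

end Series

section Data

variable (p : ℕ) [Fact p.Prime] (k : ℕ)

/-- `P_k = (T ^ 2 - 1) ^ k`. -/
def P : (ZMod p)[X] := (Polynomial.X ^ 2 - 1) ^ k

/-- `R_k`, the remainder in the euclidean division of `T ^ p` by `P_k`. -/
def R : (ZMod p)[X] := Polynomial.X ^ p % P p k

/-- `ω_k = (-1) ^ (k - 1) ∏_{1 ≤ i ≤ k} (1 - 1 / (2 i))`, used for `1 ≤ k < p / 2`. -/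
def omega : ZMod p := (-1) ^ (k - 1) * ∏ i ∈ Finset.Icc 1 k, (1 - 1 / (2 * (i : ZMod p)))

/-- The numbers `w_1, ..., w_{2k}` of `F_p`, given by `w_1 = (2k - 1) / (2k ω_k)` and
`w_{i+1} w_i = (2k - 2i - 1)(2k - 2i + 1) / (i (2k - i))` for `1 ≤ i ≤ 2k - 1`.
The values at other indices are never used. -/
def w : ℕ → ZMod p
  | 0 => 0
  | 1 => (2 * (k : ZMod p) - 1) / (2 * (k : ZMod p) * omega p k)
  | i + 2 =>
      (2 * (k : ZMod p) - 2 * ((i + 1 : ℕ) : ZMod p) - 1) *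
        (2 * (k : ZMod p) - 2 * ((i + 1 : ℕ) : ZMod p) + 1) /
        (((i + 1 : ℕ) : ZMod p) * (2 * (k : ZMod p) - ((i + 1 : ℕ) : ZMod p))) / w (i + 1)

/-- The list `w_n, w_{n+1}, ..., w_m`, for `n ≤ m`. -/
def wWord (n m : ℕ) : List (ZMod p) := (List.range' n (m + 1 - n)).map (w p k)

/-- The continuant `⟨w_n T, ..., w_{n+l-1} T⟩` with `l` entries. -/
def wContinuant (n : ℕ) : ℕ → (ZMod p)[X]
  | 0 => 1
  | 1 => Polynomial.C (w p k n) * Polynomial.X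
  | l + 2 =>
      Polynomial.C (w p k (n + l + 1)) * Polynomial.X * wContinuant n (l + 1) + wContinuant n l

/-- `K_{n,m} = ⟨w_n T, ..., w_m T⟩`, with `K_{n,n-1} = 1` and `K_{n,n-2} = 0`. -/
def K (n m : ℕ) : (ZMod p)[X] := if m + 1 < n then 0 else wContinuant p k n (m + 1 - n)

/-- The polynomial `H(V)` of `F_p[T][X]`, for `V = [p, k, j, ε]`. -/
def H (j : ℕ) (ε : ZMod p) : (ZMod p)[X][X] :=
  Polynomial.C (K p k (j + 2) (2 * k)) * Polynomial.X ^ (p + 1)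
    - Polynomial.C (K p k (j + 1) (2 * k)) * Polynomial.X ^ p
    + Polynomial.C (Polynomial.C ε) *
      (Polynomial.C (K p k 1 j) * Polynomial.X + Polynomial.C (K p k 1 (j - 1)))

/-- `ε_A = (-1) ^ (k + j + 1) [w_{j+1}, ..., w_{2k}, ω_k]`. -/
def epsA (j : ℕ) : ZMod p :=
  (-1) ^ (k + j + 1) * finCF (wWord p k (j + 1) (2 * k) ++ [omega p k])

/-- `ε_B = (-1) ^ (k + j + 1) [w_{j+1}, ..., w_{2k}]`. -/
def epsB (j : ℕ) : ZMod p :=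
  (-1) ^ (k + j + 1) * finCF (wWord p k (j + 1) (2 * k))

variable {p}

/-- `α` is the `P_k`-expansion given by the tuple `Λ = (λ_1, ..., λ_ℓ, e₁, e₂)`, where `lam` is
the list of the `λ_i`: an infinite continued fraction
`α = [λ_1 T, ..., λ_ℓ T, α_{ℓ+1}]` with `α ^ p = e₁ P_k α_{ℓ+1} + e₂ R_k`. -/
structure IsPkExpansion (lam : List (ZMod p)) (e₁ e₂ : ZMod p) (α : (ZMod p)⸨X⸩) : Prop where
  infinite : IsInfiniteCF α
  lam_ne_nil : lam ≠ []
  lam_ne_zero : ∀ x ∈ lam, x ≠ 0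
  e₁_ne_zero : e₁ ≠ 0
  expansion : ∀ (i : ℕ) (hi : i < lam.length),
    partialQuotient α i = Polynomial.C lam[i] * Polynomial.X
  pow_eq : α ^ p =
    polyEmb (Polynomial.C e₁ * P p k) * completeQuotient α lam.length
      + polyEmb (Polynomial.C e₂ * R p k)

/-- The list `λ_ℓ, λ_{ℓ-1}, ..., λ_2, λ_1 - e₂`. -/
def shiftedReverse (lam : List (ZMod p)) (e₂ : ZMod p) : List (ZMod p) :=
  (lam.modifyHead (fun x => x - e₂)).reverse

/-- The condition `H(A)` on `Λ = (λ_1, ..., λ_ℓ, e₁, e₂)` (perfect expansions of type A):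
`e₂ ≠ 0` and `[λ_ℓ, ..., λ_2, λ_1 - e₂]` is well defined and equal to `e₁ / (e₂ ω_k)`. -/
def CondA (lam : List (ZMod p)) (e₁ e₂ : ZMod p) : Prop :=
  e₂ ≠ 0 ∧ FinCFDefined (shiftedReverse lam e₂) ∧
    finCF (shiftedReverse lam e₂) = e₁ / (e₂ * omega p k)

/-- The condition `H(B)` on `Λ = (λ_1, ..., λ_ℓ, e₁, e₂)` (perfect expansions of type B):
`[λ_ℓ, ..., λ_2, λ_1 - e₂]` is well defined and equal to `0`. -/
def CondB (lam : List (ZMod p)) (e₂ : ZMod p) : Prop :=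
  FinCFDefined (shiftedReverse lam e₂) ∧ finCF (shiftedReverse lam e₂) = 0

/-- `ρ = [-2T, 2T, -2T, 2T, ...]`. -/
def IsRho (ρ : (ZMod p)⸨X⸩) : Prop :=
  IsInfiniteCF ρ ∧
    ∀ n, partialQuotient ρ n = Polynomial.C ((-1) ^ (n + 1) * 2) * Polynomial.X

variable (p) in
/-- `X ^ 2 + 2 (-1) ^ j T X + 1` in `F_p[T][X]`. -/
def quadratic (j : ℕ) : (ZMod p)[X][X] :=
  Polynomial.X ^ 2 + Polynomial.C (2 * (-1) ^ j * Polynomial.X) * Polynomial.X + 1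

end Data

end

end PkCF

/-! Everything is read off one equation. If x = [w_{j+1}T, ..., w_{2k}T, y], then x is a Möbius
transform of y whose entries are continuants and whose determinant is ±1. Splitting K_{1,2k} =
(-1)^k P_k and K_{1,2k-1} = -(-1)^k R_k after the j-th entry turns x^p = ε(-1)^{k+j}(P_k y - R_k)
into H(V)(x) = 0 (`eval₂_H_eq_zero_iff`). A contraction argument gives H(V) exactly one root of
positive degree in T (`exists_unique_root_H`), and such a root is automatically an infinite
continued fraction with the prescribed start (`isPkExpansion_iff`).

The two continuant identities come from differential equations. The product relation for the w_i
gives a lowering relation of Gegenbauer type (`IsLadder.mul_derivative_cont`). At full length it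
becomes the equation of (T^2 - 1)^k; one entry earlier it makes the derivative a multiple of (T^2 -
1)^{k-1}, as is that of R_k. Degrees below p make these equations determine the polynomials. The
antisymmetry w_{2k+1-i} = -w_i follows (`w_reverse`), and exchanges H for (j, ε) at 1/x with H for
(2k - j, 1/ε) at x; this produces β.

For perfectness, the finite continued fractions have closed forms `valA` and `valB`, both solving
v_j = w_{j+1} + 1/v_{j+1}. With ε_2 = v_j the reversed fraction telescopes to w_{2k} - v_{2k-1},
which is -1/ω_k for type A and 0 for type B.

If k = (p - 1)/2, then w_i = 2(-1)^i. Frobenius applied to ρ + T, where (ρ + T)^2 = T^2 - 1, gives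
ρ^p = P_k ρ - R_k, so (-1)^j ρ is a root and uniqueness identifies it with α. -/

open scoped Polynomial LaurentSeries

namespace PkCF

noncomputable section

/-! ### Series in 1/T: orders, polynomial parts, complete quotients. -/

section LaurentSeries

variable {F : Type*} [Field F]

theorem polyEmb_monomial (i : ℕ) (a : F) :
    polyEmb (Polynomial.monomial i a) = HahnSeries.single (-(i : ℤ)) a := by
  simp only [polyEmb, Polynomial.coe_eval₂RingHom, Polynomial.eval₂_monomial,
    HahnSeries.single_pow, HahnSeries.C_apply, HahnSeries.single_mul_single]
  simp

theorem coeff_polyEmb (f : F[X]) (m : ℤ) :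
    (polyEmb f).coeff m = if m ≤ 0 then f.coeff m.natAbs else 0 := by
  induction f using Polynomial.induction_on' with
  | add f g hf hg =>
    rw [map_add, HahnSeries.coeff_add, hf, hg, Polynomial.coeff_add]
    split_ifs <;> simp
  | monomial i a =>
    rw [polyEmb_monomial, HahnSeries.coeff_single, Polynomial.coeff_monomial]
    split_ifs <;> first | rfl | omega

theorem coeff_polyEmb_neg (f : F[X]) (n : ℕ) : (polyEmb f).coeff (-(n : ℤ)) = f.coeff n := by
  simp [coeff_polyEmb]

theorem polyEmb_injective : Function.Injective (polyEmb : F[X] →+* F⸨X⸩) := by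
  intro f g h
  ext n
  rw [← coeff_polyEmb_neg, h, coeff_polyEmb_neg]

theorem polyEmb_ne_zero {f : F[X]} (hf : f ≠ 0) : polyEmb f ≠ 0 :=
  (map_ne_zero_iff _ polyEmb_injective).2 hf

theorem order_polyEmb {f : F[X]} (hf : f ≠ 0) : (polyEmb f).order = -(f.natDegree : ℤ) := by
  apply le_antisymm
  · apply HahnSeries.order_le_of_coeff_ne_zero
    rw [coeff_polyEmb_neg]
    exact Polynomial.leadingCoeff_ne_zero.2 hf
  · rw [HahnSeries.le_order_iff_forall (polyEmb_ne_zero hf)]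
    intro m hm
    rw [coeff_polyEmb]
    split_ifs
    · apply Polynomial.coeff_eq_zero_of_natDegree_lt
      omega
    · rfl

theorem coeff_polyPart (x : F⸨X⸩) (n : ℕ) : (polyPart x).coeff n = x.coeff (-(n : ℤ)) := by
  simp only [polyPart, Polynomial.finsetSum_coeff, Polynomial.coeff_monomial]
  rw [Finset.sum_ite_eq' (Finset.range _) n]
  split_ifs with h
  · rfl
  · symm
    apply HahnSeries.coeff_eq_zero_of_lt_order
    simp only [Finset.mem_range] at h
    omega

theorem polyPart_add_of_small {f : F[X]} {s : F⸨X⸩} (hs : ∀ m ≤ 0, s.coeff m = 0) :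
    polyPart (polyEmb f + s) = f := by
  ext n
  rw [coeff_polyPart, HahnSeries.coeff_add, coeff_polyEmb_neg, hs _ (by omega), add_zero]

theorem coeff_sub_polyPart (x : F⸨X⸩) {m : ℤ} (hm : m ≤ 0) :
    (x - polyEmb (polyPart x)).coeff m = 0 := by
  obtain ⟨n, rfl⟩ : ∃ n : ℕ, m = -(n : ℤ) := ⟨m.natAbs, by omega⟩
  rw [HahnSeries.coeff_sub, coeff_polyEmb_neg, coeff_polyPart, sub_self]

theorem ne_zero_of_order_neg {x : F⸨X⸩} (hx : x.order < 0) : x ≠ 0 := by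
  rintro rfl
  simp at hx

theorem order_inv (x : F⸨X⸩) : x⁻¹.order = -x.order := by
  rcases eq_or_ne x 0 with rfl | hx
  · simp
  · have h := HahnSeries.order_mul hx (inv_ne_zero hx)
    rw [mul_inv_cancel₀ hx, HahnSeries.order_one] at h
    omega

theorem coeff_inv_of_order_neg {x : F⸨X⸩} (hx : x.order < 0) {m : ℤ} (hm : m ≤ 0) :
    x⁻¹.coeff m = 0 := by
  apply HahnSeries.coeff_eq_zero_of_lt_order
  rw [order_inv]
  omega

theorem order_inv_neg_of_small {s : F⸨X⸩} (hs : ∀ m ≤ 0, s.coeff m = 0) (h0 : s ≠ 0) :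
    s⁻¹.order < 0 := by
  rw [order_inv]
  have : (1 : ℤ) ≤ s.order := by
    rw [HahnSeries.le_order_iff_forall h0]
    intro m hm
    exact hs m (by omega)
  omega

theorem natDegree_polyPart_pos {x : F⸨X⸩} (hx : x.order < 0) : 0 < (polyPart x).natDegree := by
  have h : (polyPart x).coeff x.order.natAbs ≠ 0 := by
    rw [coeff_polyPart, show -((x.order.natAbs : ℕ) : ℤ) = x.order by omega]
    exact fun h => ne_zero_of_order_neg hx (HahnSeries.coeff_order_eq_zero.1 h)
  have := Polynomial.le_natDegree_of_ne_zero h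
  omega

theorem order_neg_of_natDegree_polyPart_pos {x : F⸨X⸩} (hx : 0 < (polyPart x).natDegree) :
    x.order < 0 := by
  have h : (polyPart x).coeff (polyPart x).natDegree ≠ 0 :=
    Polynomial.leadingCoeff_ne_zero.2 (Polynomial.ne_zero_of_natDegree_gt hx)
  rw [coeff_polyPart] at h
  have := HahnSeries.order_le_of_coeff_ne_zero h
  omega

/-- Adding a series of strictly larger order does not change the order. -/
theorem order_add_of_lt {x y : F⸨X⸩} (hx : x ≠ 0) (h : y = 0 ∨ x.order < y.order) :
    (x + y).order = x.order ∧ x + y ≠ 0 := by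
  rcases eq_or_ne y 0 with rfl | hy
  · simpa using hx
  · have h' : x.orderTop < y.orderTop := by
      rw [← HahnSeries.order_eq_orderTop_of_ne_zero hx,
        ← HahnSeries.order_eq_orderTop_of_ne_zero hy]
      exact_mod_cast h.resolve_left hy
    have e := HahnSeries.orderTop_add_eq_left h'
    have h0 : x + y ≠ 0 := by
      rw [← HahnSeries.orderTop_ne_top, e]
      exact HahnSeries.orderTop_ne_top.2 hx
    refine ⟨?_, h0⟩
    rw [← HahnSeries.order_eq_orderTop_of_ne_zero hx,
      ← HahnSeries.order_eq_orderTop_of_ne_zero h0] at e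
    exact_mod_cast e

/-- `[l_1 T, ..., l_n T, x]`. -/
def cfEval (l : List F) (x : F⸨X⸩) : F⸨X⸩ :=
  l.foldr (fun a y => polyEmb (Polynomial.C a * Polynomial.X) + y⁻¹) x

@[simp] theorem cfEval_nil (x : F⸨X⸩) : cfEval [] x = x := rfl

@[simp] theorem cfEval_cons (a : F) (l : List F) (x : F⸨X⸩) :
    cfEval (a :: l) x = polyEmb (Polynomial.C a * Polynomial.X) + (cfEval l x)⁻¹ := rfl

theorem order_cfEval_neg {l : List F} (hl : ∀ a ∈ l, a ≠ 0) {x : F⸨X⸩} (hx : x.order < 0) :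
    (cfEval l x).order < 0 := by
  induction l with
  | nil => exact hx
  | cons a l ih =>
    have ih := ih fun b hb => hl b (List.mem_cons_of_mem _ hb)
    apply order_neg_of_natDegree_polyPart_pos
    rw [cfEval_cons, polyPart_add_of_small fun m hm => coeff_inv_of_order_neg ih hm,
      Polynomial.natDegree_C_mul_X _ (hl a List.mem_cons_self)]
    exact one_pos

theorem completeQuotient_add (x : F⸨X⸩) (m n : ℕ) :
    completeQuotient x (m + n) = completeQuotient (completeQuotient x m) n := by
  induction n with
  | zero => rfl
  | succ n ih => rw [← add_assoc, completeQuotient, completeQuotient, ih]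

theorem completeQuotient_one_cfEval {a : F} {l : List F} (hl : ∀ b ∈ l, b ≠ 0) {x : F⸨X⸩}
    (hx : x.order < 0) :
    polyPart (cfEval (a :: l) x) = Polynomial.C a * Polynomial.X ∧
      completeQuotient (cfEval (a :: l) x) 1 = cfEval l x := by
  have h : polyPart (cfEval (a :: l) x) = Polynomial.C a * Polynomial.X := by
    rw [cfEval_cons, polyPart_add_of_small fun m hm =>
      coeff_inv_of_order_neg (order_cfEval_neg hl hx) hm]
  refine ⟨h, ?_⟩
  rw [completeQuotient, completeQuotient, h, cfEval_cons, add_sub_cancel_left, inv_inv]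

theorem completeQuotient_cfEval {l : List F} (hl : ∀ a ∈ l, a ≠ 0) {x : F⸨X⸩} (hx : x.order < 0)
    (i : ℕ) (hi : i ≤ l.length) : completeQuotient (cfEval l x) i = cfEval (l.drop i) x := by
  induction l generalizing i with
  | nil =>
    obtain rfl : i = 0 := by simpa using hi
    rfl
  | cons a l ih =>
    have hl' : ∀ b ∈ l, b ≠ 0 := fun b hb => hl b (List.mem_cons_of_mem _ hb)
    cases i with
    | zero => rfl
    | succ i =>
      rw [add_comm i 1, completeQuotient_add, (completeQuotient_one_cfEval hl' hx).2,
        ih hl' i (by simpa using hi), add_comm 1 i, List.drop_succ_cons]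

theorem partialQuotient_cfEval {l : List F} (hl : ∀ a ∈ l, a ≠ 0) {x : F⸨X⸩} (hx : x.order < 0)
    (i : ℕ) (hi : i < l.length) :
    partialQuotient (cfEval l x) i = Polynomial.C l[i] * Polynomial.X := by
  rw [partialQuotient, completeQuotient_cfEval hl hx i hi.le, List.drop_eq_getElem_cons hi]
  exact (completeQuotient_one_cfEval
    (fun b hb => hl b (List.mem_of_mem_drop hb)) hx).1

theorem eq_cfEval_completeQuotient (l : List F) (x : F⸨X⸩)
    (h : ∀ (i : ℕ) (hi : i < l.length), partialQuotient x i = Polynomial.C l[i] * Polynomial.X) :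
    x = cfEval l (completeQuotient x l.length) := by
  induction l generalizing x with
  | nil => rfl
  | cons a l ih =>
    have h0 : polyPart x = Polynomial.C a * Polynomial.X := h 0 (by simp)
    have h1 := ih (completeQuotient x 1) (fun i hi => by
      rw [partialQuotient, ← completeQuotient_add, add_comm]
      exact h (i + 1) (by simpa using hi))
    rw [cfEval_cons, List.length_cons, add_comm l.length 1, completeQuotient_add, ← h1, ← h0,
      completeQuotient, completeQuotient, inv_inv]
    ring

theorem IsInfiniteCF.order_neg {x : F⸨X⸩} (h : IsInfiniteCF x) (n : ℕ) :
    (completeQuotient x n).order < 0 :=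
  order_neg_of_natDegree_polyPart_pos (h n).2

/-! ### Rational series and infinite expansions. -/

/-- `x` is the quotient of two polynomials. -/
def IsRational (x : F⸨X⸩) : Prop :=
  ∃ U V : F[X], V ≠ 0 ∧ x * polyEmb V = polyEmb U

theorem isRational_polyEmb (f : F[X]) : IsRational (polyEmb f) := ⟨f, 1, one_ne_zero, by simp⟩

theorem IsRational.inv {x : F⸨X⸩} (hx : IsRational x) : IsRational x⁻¹ := by
  rcases eq_or_ne x 0 with rfl | h0
  · rwa [inv_zero]
  · obtain ⟨U, V, hV, h⟩ := hx
    refine ⟨V, U, ?_, ?_⟩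
    · rintro rfl
      rw [map_zero] at h
      exact mul_ne_zero h0 (polyEmb_ne_zero hV) h
    · rw [← h, inv_mul_cancel_left₀ h0]

theorem IsRational.add_polyEmb {x : F⸨X⸩} (hx : IsRational x) (f : F[X]) :
    IsRational (x + polyEmb f) := by
  obtain ⟨U, V, hV, h⟩ := hx
  refine ⟨U + f * V, V, hV, ?_⟩
  rw [add_mul, h, map_add, map_mul]

theorem IsRational.coprime {x : F⸨X⸩} (hx : IsRational x) :
    ∃ U V : F[X], V ≠ 0 ∧ IsCoprime U V ∧ x * polyEmb V = polyEmb U := by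
  classical
  obtain ⟨U, V, hV, h⟩ := hx
  obtain ⟨U', hU'⟩ := EuclideanDomain.gcd_dvd_left U V
  obtain ⟨V', hV'⟩ := EuclideanDomain.gcd_dvd_right U V
  have hg : EuclideanDomain.gcd U V ≠ 0 := fun h => hV (EuclideanDomain.gcd_eq_zero_iff.1 h).2
  refine ⟨U', V', ?_, ?_, ?_⟩
  · rintro rfl
    exact hV (by rw [hV', mul_zero])
  · have e := EuclideanDomain.gcd_eq_gcd_ab U V
    refine ⟨EuclideanDomain.gcdA U V, EuclideanDomain.gcdB U V, mul_left_cancel₀ hg ?_⟩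
    calc _ = (EuclideanDomain.gcd U V * U') * EuclideanDomain.gcdA U V +
          (EuclideanDomain.gcd U V * V') * EuclideanDomain.gcdB U V := by ring
      _ = _ := by rw [← hU', ← hV', mul_one, ← e]
  · apply mul_left_cancel₀ (polyEmb_ne_zero hg)
    rw [← map_mul, ← hU', ← h, hV']
    conv_rhs => rw [hV', map_mul]
    rw [← hV']
    ring

/-- Subtracting a polynomial and inverting both preserve irrationality, so the expansion never meets
a polynomial and cannot stop. -/
theorem isInfiniteCF_of_not_isRational {x : F⸨X⸩} (hx : x.order < 0) (h : ¬ IsRational x) :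
    IsInfiniteCF x := by
  have key : ∀ n, (completeQuotient x n).order < 0 ∧ ¬ IsRational (completeQuotient x n) := by
    intro n
    induction n with
    | zero => exact ⟨hx, h⟩
    | succ n ih =>
      have hne : completeQuotient x n - polyEmb (polyPart (completeQuotient x n)) ≠ 0 := by
        intro h0
        apply ih.2
        rw [sub_eq_zero.1 h0]
        exact isRational_polyEmb _
      refine ⟨order_inv_neg_of_small (fun m hm => coeff_sub_polyPart _ hm) hne, fun hr => ih.2 ?_⟩
      have := hr.inv.add_polyEmb (polyPart (completeQuotient x n))
      rwa [completeQuotient, inv_inv, sub_add_cancel] at this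
  intro n
  refine ⟨fun h0 => (key n).2 ?_, natDegree_polyPart_pos (key n).1⟩
  rw [h0]
  exact isRational_polyEmb _

/-- Euclid's algorithm: the next complete quotient has denominator U - `polyPart x` * V, of smaller
degree than V, so the expansion of U/V stops. -/
theorem IsInfiniteCF.not_isRational_aux (d : ℕ) : ∀ (x : F⸨X⸩) (U V : F[X]), V.natDegree ≤ d →
    V ≠ 0 → x * polyEmb V = polyEmb U → IsInfiniteCF x → False := by
  induction d with
  | zero =>
    intro x U V hd hV h hx
    rw [Polynomial.eq_C_of_natDegree_le_zero hd] at h hV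
    have hc : V.coeff 0 ≠ 0 := by simpa using hV
    have hx' : x = polyEmb (U * Polynomial.C (V.coeff 0)⁻¹) := by
      rw [map_mul, ← h, mul_assoc, ← map_mul, ← Polynomial.C_mul, mul_inv_cancel₀ hc]
      simp
    have := (hx 0).1
    rw [partialQuotient, completeQuotient] at this
    apply this
    have e := polyPart_add_of_small (f := U * Polynomial.C (V.coeff 0)⁻¹) (s := 0) (by simp)
    rw [add_zero, ← hx'] at e
    rw [e, ← hx']
  | succ d ih =>
    intro x U V hd hV h hx
    have hne : x - polyEmb (polyPart x) ≠ 0 := sub_ne_zero.2 (hx 0).1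
    have hW : (x - polyEmb (polyPart x)) * polyEmb V = polyEmb (U - polyPart x * V) := by
      rw [sub_mul, h, map_sub, map_mul]
    have hW0 : U - polyPart x * V ≠ 0 := by
      intro h0
      rw [h0, map_zero] at hW
      exact mul_ne_zero hne (polyEmb_ne_zero hV) hW
    refine ih (completeQuotient x 1) V (U - polyPart x * V) ?_ hW0 ?_ ?_
    · have ho := congrArg HahnSeries.order hW
      rw [HahnSeries.order_mul hne (polyEmb_ne_zero hV), order_polyEmb hV, order_polyEmb hW0] at ho
      have := order_inv_neg_of_small (fun m hm => coeff_sub_polyPart x hm) hne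
      rw [order_inv] at this
      omega
    · rw [completeQuotient, completeQuotient, ← hW, inv_mul_cancel_left₀ hne]
    · intro n
      have := hx (1 + n)
      rwa [partialQuotient, completeQuotient_add] at this

theorem IsInfiniteCF.not_isRational {x : F⸨X⸩} (hx : IsInfiniteCF x) : ¬ IsRational x :=
  fun ⟨U, V, hV, h⟩ => IsInfiniteCF.not_isRational_aux V.natDegree x U V le_rfl hV h hx

/-! ### Roots of positive degree by contraction. -/

theorem exists_fixedPoint (f : PowerSeries F → PowerSeries F)
    (hf : ∀ (n : ℕ) (u v : PowerSeries F), PowerSeries.X ^ n ∣ u - v →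
      PowerSeries.X ^ (n + 1) ∣ f u - f v) : ∃ y, f y = y := by
  have h1 : ∀ n m : ℕ, PowerSeries.X ^ n ∣ f^[n + m] 0 - f^[n] 0 := by
    intro n m
    induction n with
    | zero => simp
    | succ n ih =>
      rw [show n + 1 + m = n + m + 1 by ring, Function.iterate_succ_apply',
        Function.iterate_succ_apply']
      exact hf _ _ _ ih
  -- The n-th coefficient is stable from the (n+1)-st iterate on, so this diagonal is the X-adic
  -- limit of the iterates of 0.
  let y : PowerSeries F := PowerSeries.mk fun n => PowerSeries.coeff n (f^[n + 1] 0)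
  have h2 : ∀ n, PowerSeries.X ^ n ∣ y - f^[n] 0 := by
    intro n
    rw [PowerSeries.X_pow_dvd_iff]
    intro m hm
    obtain ⟨d, rfl⟩ := Nat.exists_eq_add_of_lt hm
    have := (PowerSeries.X_pow_dvd_iff.1 (h1 (m + 1) d)) m (Nat.lt_succ_self m)
    rw [map_sub, sub_eq_zero] at this
    rw [map_sub, PowerSeries.coeff_mk, show m + d + 1 = m + 1 + d by ring, this, sub_self]
  refine ⟨y, ?_⟩
  ext n
  have h3 : PowerSeries.X ^ (n + 1) ∣ f y - y := by
    have := dvd_sub (hf n _ _ (h2 n)) (h2 (n + 1))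
    rwa [Function.iterate_succ_apply', sub_sub_sub_cancel_right] at this
  have := (PowerSeries.X_pow_dvd_iff.1 h3) n (Nat.lt_succ_self n)
  rwa [map_sub, sub_eq_zero] at this

/-- The power series `X ^ n f(1/X)`, for `f` of degree at most `n`. -/
theorem exists_powerSeries_eq {f : F[X]} {n : ℕ} (hf : f.natDegree ≤ n) :
    ∃ g : PowerSeries F, PowerSeries.constantCoeff g = f.coeff n ∧
      (g : F⸨X⸩) = HahnSeries.single (n : ℤ) 1 * polyEmb f := by
  refine ⟨PowerSeries.mk fun i => if i ≤ n then f.coeff (n - i) else 0, ?_, ?_⟩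
  · simp [← PowerSeries.coeff_zero_eq_constantCoeff_apply]
  · ext m
    rw [PowerSeries.coeff_coe, HahnSeries.coeff_single_mul, one_mul, coeff_polyEmb,
      PowerSeries.coeff_mk]
    split_ifs <;> first | rfl | omega | skip
    · symm
      apply Polynomial.coeff_eq_zero_of_natDegree_lt
      omega
    · congr 1
      omega

theorem exists_powerSeries_of_order_neg {x : F⸨X⸩} (hx : x.order < 0) :
    ∃ y : PowerSeries F, x⁻¹ = ((PowerSeries.X * y : PowerSeries F) : F⸨X⸩) := by
  refine ⟨PowerSeries.mk fun i => x⁻¹.coeff ((i : ℤ) + 1), ?_⟩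
  ext m
  rw [PowerSeries.coeff_coe]
  split_ifs with h
  · exact coeff_inv_of_order_neg hx h.le
  · obtain ⟨i, rfl⟩ := Int.eq_ofNat_of_zero_le (not_lt.1 h)
    cases i with
    | zero => simpa using coeff_inv_of_order_neg hx le_rfl
    | succ i =>
      rw [Int.natAbs_natCast, PowerSeries.coeff_succ_X_mul, PowerSeries.coeff_mk]
      simp

theorem order_inv_coe_X_mul_neg {y : PowerSeries F} (hy : y ≠ 0) :
    ((PowerSeries.X * y : PowerSeries F) : F⸨X⸩)⁻¹.order < 0 := by
  apply order_inv_neg_of_small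
  · intro m hm
    rw [PowerSeries.coeff_coe]
    split_ifs with h
    · rfl
    · obtain rfl : m = 0 := by omega
      simp
  · rw [← PowerSeries.coe_zero, (HahnSeries.ofPowerSeries_injective (Γ := ℤ)).ne_iff]
    exact mul_ne_zero PowerSeries.X_ne_zero hy

/-- Solving for the linear term gives v = a⁻¹(c + X(...)), whose right-hand side is an X-adic
contraction. Two solutions differ by X r times their own difference, hence coincide; c ≠ 0 excludes
v = 0. -/
theorem exists_powerSeries_root (a c e g : PowerSeries F) {p : ℕ}
    (hp : p ≠ 0) (ha : PowerSeries.constantCoeff a ≠ 0) (hc : c ≠ 0) :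
    ∃ y : PowerSeries F, y ≠ 0 ∧
      ∀ v, c - a * v + PowerSeries.X * (e * v ^ p + g * v ^ (p + 1)) = 0 ↔ v = y := by
  have haa : a * a⁻¹ = 1 := PowerSeries.mul_inv_cancel a ha
  have hiff : ∀ v, c - a * v + PowerSeries.X * (e * v ^ p + g * v ^ (p + 1)) = 0 ↔
      a⁻¹ * (c + PowerSeries.X * (e * v ^ p + g * v ^ (p + 1))) = v := by
    intro v
    constructor <;> intro h
    · linear_combination a⁻¹ * h + v * haa
    · linear_combination a * h - (c + PowerSeries.X * (e * v ^ p + g * v ^ (p + 1))) * haa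
  have hdvd : ∀ u v : PowerSeries F, PowerSeries.X * (u - v) ∣
      a⁻¹ * (c + PowerSeries.X * (e * u ^ p + g * u ^ (p + 1))) -
        a⁻¹ * (c + PowerSeries.X * (e * v ^ p + g * v ^ (p + 1))) := by
    intro u v
    obtain ⟨r, hr⟩ := sub_dvd_pow_sub_pow u v p
    obtain ⟨s, hs⟩ := sub_dvd_pow_sub_pow u v (p + 1)
    refine ⟨a⁻¹ * (e * r + g * s), ?_⟩
    linear_combination a⁻¹ * PowerSeries.X * e * hr + a⁻¹ * PowerSeries.X * g * hs
  obtain ⟨y, hy⟩ := exists_fixedPoint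
    (fun v => a⁻¹ * (c + PowerSeries.X * (e * v ^ p + g * v ^ (p + 1)))) (by
      intro n u v h
      rw [pow_succ']
      exact (mul_dvd_mul_left _ h).trans (hdvd u v))
  have huniq : ∀ v, c - a * v + PowerSeries.X * (e * v ^ p + g * v ^ (p + 1)) = 0 ↔ v = y := by
    intro v
    rw [hiff]
    constructor
    · intro hv
      obtain ⟨r, hr⟩ := hdvd v y
      rw [hv, show a⁻¹ * (c + PowerSeries.X * (e * y ^ p + g * y ^ (p + 1))) = y from hy] at hr
      have h0 : (v - y) * (1 - PowerSeries.X * r) = 0 := by linear_combination hr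
      rcases mul_eq_zero.1 h0 with h | h
      · exact sub_eq_zero.1 h
      · have := congrArg PowerSeries.constantCoeff h
        simp at this
    · rintro rfl
      exact hy
  refine ⟨y, ?_, huniq⟩
  rintro rfl
  have h := (huniq 0).2 rfl
  rw [zero_pow hp, zero_pow (Nat.succ_ne_zero p)] at h
  exact hc (by simpa using h)

/-- A polynomial equation whose coefficients have suitable degrees has a unique root of
positive degree. -/
theorem exists_unique_root {A C E G : F[X]} {p n m : ℕ} (hp : p ≠ 0)
    (hA : A.natDegree = n + 1)
    (hC : C.natDegree ≤ n) (hC0 : C ≠ 0) (hm : m + 1 = p + n) (hE : E.natDegree ≤ m)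
    (hG : G.natDegree ≤ m + 1) :
    ∃ x : F⸨X⸩, ∀ z, (z.order < 0 ∧ polyEmb C * z ^ (p + 1) - polyEmb A * z ^ p +
      (polyEmb E * z + polyEmb G) = 0) ↔ z = x := by
  -- Put t = 1/T and z = 1/(t v). Multiplying the equation by (t v)^(p+1) t^n makes all coefficients
  -- power series in t, and m + 1 = p + n leaves exactly one spare factor t in front of the last two
  -- terms.
  obtain ⟨a, ha, ha'⟩ := exists_powerSeries_eq hA.le
  obtain ⟨c, -, hc'⟩ := exists_powerSeries_eq hC
  obtain ⟨e, -, he'⟩ := exists_powerSeries_eq hE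
  obtain ⟨g, -, hg'⟩ := exists_powerSeries_eq hG
  have hA0 : A ≠ 0 := Polynomial.ne_zero_of_natDegree_gt (n := n) (by omega)
  have ht : ∀ i : ℕ, (HahnSeries.single (i : ℤ) (1 : F) : F⸨X⸩) =
      (HahnSeries.single (1 : ℤ) (1 : F)) ^ i := by
    intro i
    simp [HahnSeries.single_pow]
  rw [ht] at ha' hc' he' hg'
  have ht0 : (HahnSeries.single (1 : ℤ) (1 : F) : F⸨X⸩) ≠ 0 := by simp
  have hc : c ≠ 0 := by
    rintro rfl
    rw [PowerSeries.coe_zero] at hc'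
    exact mul_ne_zero (pow_ne_zero _ ht0) (polyEmb_ne_zero hC0) hc'.symm
  obtain ⟨y, hy0, hy⟩ := exists_powerSeries_root a c e g hp
    (by rw [ha, ← hA]; exact Polynomial.leadingCoeff_ne_zero.2 hA0) hc
  have key : ∀ v : PowerSeries F, v ≠ 0 →
      (polyEmb C * (((PowerSeries.X * v : PowerSeries F) : F⸨X⸩)⁻¹) ^ (p + 1) -
        polyEmb A * (((PowerSeries.X * v : PowerSeries F) : F⸨X⸩)⁻¹) ^ p +
      (polyEmb E * ((PowerSeries.X * v : PowerSeries F) : F⸨X⸩)⁻¹ + polyEmb G) = 0 ↔ v = y) := by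
    intro v hv
    rw [← hy, ← (HahnSeries.ofPowerSeries_injective (Γ := ℤ)).eq_iff]
    have hv' : (v : F⸨X⸩) ≠ 0 := by
      rwa [← PowerSeries.coe_zero, (HahnSeries.ofPowerSeries_injective (Γ := ℤ)).ne_iff]
    simp only [map_mul, map_add, map_sub, map_pow, map_zero, ha', hc', he', hg',
      HahnSeries.ofPowerSeries_X]
    set t : F⸨X⸩ := HahnSeries.single (1 : ℤ) (1 : F)
    set V : F⸨X⸩ := HahnSeries.ofPowerSeries ℤ F v
    have hZ : t * V ≠ 0 := mul_ne_zero ht0 hv'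
    set Z := t * V with hZdef
    have e1 : (polyEmb C * Z⁻¹ ^ (p + 1) - polyEmb A * Z⁻¹ ^ p +
        (polyEmb E * Z⁻¹ + polyEmb G)) * (Z ^ (p + 1) * t ^ n) =
        t ^ n * polyEmb C - t ^ (n + 1) * polyEmb A * V +
          t * (t ^ m * polyEmb E * V ^ p + t ^ (m + 1) * polyEmb G * V ^ (p + 1)) := by
      have h1 : Z⁻¹ ^ (p + 1) * Z ^ (p + 1) = 1 := by
        rw [← mul_pow, inv_mul_cancel₀ hZ, one_pow]
      have h2 : Z⁻¹ ^ p * Z ^ p = 1 := by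
        rw [← mul_pow, inv_mul_cancel₀ hZ, one_pow]
      have h3 : Z⁻¹ * Z = 1 := inv_mul_cancel₀ hZ
      have h4 : t * t ^ m = t ^ p * t ^ n := by rw [← pow_succ', hm, pow_add]
      have h5 : Z ^ p = t ^ p * V ^ p := by rw [hZdef, mul_pow]
      calc _ = polyEmb C * t ^ n * (Z⁻¹ ^ (p + 1) * Z ^ (p + 1)) -
            polyEmb A * t ^ n * Z * (Z⁻¹ ^ p * Z ^ p) +
            (polyEmb E * t ^ n * Z ^ p * (Z⁻¹ * Z) + polyEmb G * t ^ n * (Z ^ p * Z)) := by ring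
        _ = polyEmb C * t ^ n - polyEmb A * t ^ n * (t * V) +
            (polyEmb E * V ^ p * (t ^ p * t ^ n) +
              polyEmb G * V ^ (p + 1) * t * (t ^ p * t ^ n)) := by
            rw [h1, h2, h3, h5, hZdef]; ring
        _ = _ := by rw [← h4]; ring
    rw [← e1, mul_eq_zero, or_iff_left]
    exact mul_ne_zero (pow_ne_zero _ hZ) (pow_ne_zero _ ht0)
  refine ⟨((PowerSeries.X * y : PowerSeries F) : F⸨X⸩)⁻¹, fun z => ⟨?_, ?_⟩⟩
  · rintro ⟨hz, h⟩
    obtain ⟨v, hv⟩ := exists_powerSeries_of_order_neg hz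
    have hv0 : v ≠ 0 := by
      rintro rfl
      rw [mul_zero, PowerSeries.coe_zero, inv_eq_zero] at hv
      exact ne_zero_of_order_neg hz hv
    have hz' : z = ((PowerSeries.X * v : PowerSeries F) : F⸨X⸩)⁻¹ := by rw [← hv, inv_inv]
    rw [hz'] at h ⊢
    rw [(key v hv0).1 h]
  · rintro rfl
    exact ⟨order_inv_coe_X_mul_neg hy0, (key y hy0).2 rfl⟩

end LaurentSeries

/-! ### Continuants of words u_n T, u_{n+1} T, ... -/

section Continuant

variable {F : Type*} [Field F]

/-- `cont u n (l + 1)` is the continuant `⟨u_n T, ..., u_{n+l-1} T⟩`, and `cont u n 0 = 0`. -/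
def cont (u : ℕ → F) (n : ℕ) : ℕ → F[X]
  | 0 => 0
  | 1 => 1
  | l + 2 => Polynomial.C (u (n + l)) * Polynomial.X * cont u n (l + 1) + cont u n l

theorem cont_zero (u : ℕ → F) (n : ℕ) : cont u n 0 = 0 := rfl

theorem cont_one (u : ℕ → F) (n : ℕ) : cont u n 1 = 1 := rfl

theorem cont_add_two (u : ℕ → F) (n l : ℕ) : cont u n (l + 2) =
    Polynomial.C (u (n + l)) * Polynomial.X * cont u n (l + 1) + cont u n l := rfl

/-- Euler's rule for cutting a word after its a-th entry. The shifted index, with value 0 at index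
0, lets it hold for a = 0 and b = 0 as well. -/
theorem cont_add (u : ℕ → F) (n a b : ℕ) : cont u n (a + b + 1) =
    cont u n (a + 1) * cont u (n + a) (b + 1) + cont u n a * cont u (n + a + 1) b := by
  induction b using Nat.strong_induction_on with
  | _ b ih =>
    match b with
    | 0 => simp [cont_zero, cont_one]
    | 1 =>
      rw [cont_add_two u n a, cont_add_two u (n + a) 0, cont_one, cont_one, cont_zero, add_zero]
      ring_nf
    | b + 2 =>
      have h0 := ih b (by omega)
      have h1 := ih (b + 1) (by omega)
      rw [show a + (b + 2) + 1 = (a + b + 1) + 2 by ring, cont_add_two,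
        show a + b + 1 + 1 = a + (b + 1) + 1 by ring, h0, h1, cont_add_two u (n + a) (b + 1),
        cont_add_two u (n + a + 1) b, show n + (a + b + 1) = n + a + (b + 1) by ring,
        show n + a + 1 + b = n + a + (b + 1) by ring]
      ring

theorem cont_add_two_left (u : ℕ → F) (n l : ℕ) : cont u n (l + 2) =
    Polynomial.C (u n) * Polynomial.X * cont u (n + 1) (l + 1) + cont u (n + 2) l := by
  rw [show l + 2 = 1 + l + 1 by ring, cont_add, cont_add_two, cont_one, cont_zero]
  ring_nf

/-- A continuant can be expanded at either end, so it is invariant under reversal of the word. -/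
theorem cont_eq_of_reverse (u v : ℕ → F) (l : ℕ) :
    ∀ n m, (∀ i < l, v (m + i) = u (n + (l - 1 - i))) → cont v m (l + 1) = cont u n (l + 1) := by
  induction l using Nat.strong_induction_on with
  | _ l ih =>
    intro n m h
    match l with
    | 0 => rfl
    | 1 =>
      have := h 0 (by omega)
      rw [cont_add_two, cont_add_two, this]
      rfl
    | l + 2 =>
      rw [cont_add_two, cont_add_two_left u, ih (l + 1) (by omega) (n + 1) m,
        ih l (by omega) (n + 2) m, h (l + 1) (by omega)]
      · simp
      · intro i hi
        rw [h i (by omega)]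
        congr 1
        omega
      · intro i hi
        rw [h i (by omega)]
        congr 1
        omega

theorem cont_neg (u v : ℕ → F) (n m l : ℕ) (h : ∀ i < l, v (m + i) = -u (n + i)) :
    cont v m (l + 1) = (-1) ^ l * cont u n (l + 1) := by
  induction l using Nat.strong_induction_on with
  | _ l ih =>
    match l with
    | 0 => simp [cont_one]
    | 1 =>
      have := h 0 (by omega)
      rw [cont_add_two, cont_add_two, this]
      simp [cont_one, cont_zero]
    | l + 2 =>
      rw [cont_add_two v m (l + 1), cont_add_two u n (l + 1),
        ih (l + 1) (by omega) fun i hi => h i (by omega),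
        ih l (by omega) fun i hi => h i (by omega), h (l + 1) (by omega), Polynomial.C_neg]
      ring

/-- Determinant of a product of matrices (u_i T, 1; 1, 0), each of determinant -1. -/
theorem cont_det (u : ℕ → F) (n l : ℕ) : cont u n (l + 2) * cont u (n + 1) l -
    cont u n (l + 1) * cont u (n + 1) (l + 1) = (-1) ^ (l + 1) := by
  induction l with
  | zero => simp [cont_zero, cont_one]
  | succ l ih =>
    rw [cont_add_two u n (l + 1), cont_add_two u (n + 1) l, show n + (l + 1) = n + 1 + l by ring,
      pow_succ, ← ih]
    ring

theorem natDegree_cont_le (u : ℕ → F) (n l : ℕ) : (cont u n (l + 1)).natDegree ≤ l := by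
  induction l using Nat.strong_induction_on with
  | _ l ih =>
    match l with
    | 0 => simp [cont_one]
    | 1 =>
      rw [cont_add_two, cont_zero, cont_one, mul_one, add_zero]
      exact (Polynomial.natDegree_C_mul_le _ _).trans Polynomial.natDegree_X_le
    | l + 2 =>
      rw [cont_add_two]
      refine Polynomial.natDegree_add_le_of_degree_le ?_ ((ih l (by omega)).trans (by omega))
      refine (Polynomial.natDegree_mul_le_of_le ((Polynomial.natDegree_C_mul_le _ _).trans
        Polynomial.natDegree_X_le) (ih (l + 1) (by omega))).trans (by omega)

theorem coeff_cont (u : ℕ → F) (n l : ℕ) :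
    (cont u n (l + 1)).coeff l = ∏ i ∈ Finset.range l, u (n + i) := by
  induction l with
  | zero => simp [cont_one]
  | succ l ih =>
    rw [cont_add_two, Polynomial.coeff_add, mul_assoc, Polynomial.coeff_C_mul,
      Polynomial.coeff_X_mul, ih, Finset.prod_range_succ, mul_comm]
    cases l with
    | zero => simp [cont_zero]
    | succ l =>
      rw [Polynomial.coeff_eq_zero_of_natDegree_lt, add_zero]
      exact (natDegree_cont_le u n l).trans_lt (by omega)

theorem coeff_cont_ne_zero {u : ℕ → F} {n l : ℕ} (h : ∀ i < l, u (n + i) ≠ 0) :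
    (cont u n (l + 1)).coeff l ≠ 0 := by
  rw [coeff_cont]
  exact Finset.prod_ne_zero_iff.2 fun i hi => h i (Finset.mem_range.1 hi)

theorem natDegree_cont {u : ℕ → F} {n l : ℕ} (h : ∀ i < l, u (n + i) ≠ 0) :
    (cont u n (l + 1)).natDegree = l :=
  le_antisymm (natDegree_cont_le u n l) (Polynomial.le_natDegree_of_ne_zero (coeff_cont_ne_zero h))

theorem cont_ne_zero {u : ℕ → F} {n l : ℕ} (h : ∀ i < l, u (n + i) ≠ 0) :
    cont u n (l + 1) ≠ 0 := by
  intro h0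
  apply coeff_cont_ne_zero h
  rw [h0, Polynomial.coeff_zero]

/-- These constant terms serve as initial values for the differential equations below. -/
theorem eval_zero_cont (u : ℕ → F) (n l : ℕ) :
    (cont u n (2 * l)).eval 0 = 0 ∧ (cont u n (2 * l + 1)).eval 0 = 1 := by
  induction l with
  | zero => simp [cont_zero, cont_one]
  | succ l ih =>
    have h1 : (cont u n (2 * (l + 1))).eval 0 = 0 := by
      rw [show 2 * (l + 1) = 2 * l + 2 by ring, cont_add_two]
      simp [ih.1]
    refine ⟨h1, ?_⟩
    rw [show 2 * (l + 1) + 1 = (2 * l + 1) + 2 by ring, cont_add_two]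
    simp [ih.2]

/-- The Möbius action of the continuant matrix on the tail x, with the denominator cleared. -/
theorem cfEval_mul_cont (u : ℕ → F) (l : ℕ) : ∀ (n : ℕ), (∀ i ≤ l, u (n + i) ≠ 0) →
    ∀ {x : F⸨X⸩}, x.order < 0 →
    cfEval ((List.range' n (l + 1)).map u) x *
      (polyEmb (cont u (n + 1) (l + 1)) * x + polyEmb (cont u (n + 1) l)) =
      polyEmb (cont u n (l + 2)) * x + polyEmb (cont u n (l + 1)) := by
  induction l with
  | zero =>
    intro n _ x hx
    have := ne_zero_of_order_neg hx
    simp [cont_zero, cont_one, cont_add_two]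
    field_simp
  | succ l ih =>
    intro n hu x hx
    have hu' : ∀ i ≤ l, u (n + 1 + i) ≠ 0 := fun i hi => by
      rw [add_assoc, add_comm 1]
      exact hu (i + 1) (by omega)
    have h := ih (n + 1) hu' hx
    have h0 : cfEval ((List.range' (n + 1) (l + 1)).map u) x ≠ 0 := by
      apply ne_zero_of_order_neg
      apply order_cfEval_neg _ hx
      intro a ha
      obtain ⟨i, hi, rfl⟩ := List.mem_map.1 ha
      obtain ⟨d, hd, rfl⟩ := List.mem_range'.1 hi
      simpa using hu' d (by omega)
    rw [List.range'_succ, List.map_cons, cfEval_cons, add_mul, ← h, inv_mul_cancel_left₀ h0, h,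
      cont_add_two_left u n (l + 1), cont_add_two_left u n l]
    simp only [map_add, map_mul]
    ring

end Continuant

/-! ### Differential relations for the continuants. -/

section Ladder

open Polynomial

variable {F : Type*} [Field F] {k : ℕ} {u : ℕ → F}

/-- Differentiating the three-term recurrence combines two consecutive lowering relations into the
next. No condition on u enters, so the step serves both below full length, where the product
relation rewrites the coefficient, and at full length, where it vanishes. -/
theorem cont_ladder_step (m : ℕ)
    (h0 : C (u (m + 1)) * ((X ^ 2 - 1) * derivative (cont u 1 (m + 1)) -
      C (m : F) * X * cont u 1 (m + 1)) = -C (2 * k - 2 * m - 1 : F) * cont u 1 m)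
    (h1 : C (u (m + 2)) * ((X ^ 2 - 1) * derivative (cont u 1 (m + 2)) -
      C (m + 1 : F) * X * cont u 1 (m + 2)) = -C (2 * k - 2 * m - 3 : F) * cont u 1 (m + 1)) :
    C (u (m + 1)) * ((X ^ 2 - 1) * derivative (cont u 1 (m + 3)) -
      C (m + 2 : F) * X * cont u 1 (m + 3)) =
      -C (u (m + 1) * u (m + 2) + 2 * k - 2 * m - 1 : F) * cont u 1 (m + 2) := by
  have e1 : cont u 1 (m + 3) = C (u (m + 2)) * X * cont u 1 (m + 2) + cont u 1 (m + 1) := by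
    rw [cont_add_two u 1 (m + 1), show 1 + (m + 1) = m + 2 by ring]
  have e2 : cont u 1 m = cont u 1 (m + 2) - C (u (m + 1)) * X * cont u 1 (m + 1) := by
    rw [cont_add_two u 1 m, show 1 + m = m + 1 by ring]
    ring
  rw [e2] at h0
  rw [e1]
  simp only [derivative_mul, derivative_C, derivative_X, map_add, map_sub,
    map_mul, map_natCast, map_ofNat, map_one] at h0 h1 ⊢
  linear_combination h0 + C (u (m + 1)) * X * h1

/-- The conditions on `u_1, ..., u_{2k}` under which the continuants `⟨u_1 T, ..., u_n T⟩` are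
proportional to Gegenbauer polynomials. -/
structure IsLadder (k : ℕ) (u : ℕ → F) : Prop where
  mul_eq : ∀ i, 1 ≤ i → i < 2 * k → u (i + 1) * u i * (i * (2 * k - i)) =
    (2 * k - 2 * i - 1 : F) * (2 * k - 2 * i + 1)
  ne_zero : ∀ i, 1 ≤ i → i ≤ 2 * k → u i ≠ 0
  two_mul_sub_one_ne_zero : (2 * k - 1 : F) ≠ 0
  mul_sub_ne_zero : ∀ i, 1 ≤ i → i < 2 * k → (i * (2 * k - i) : F) ≠ 0

namespace IsLadder

theorem mul_derivative_cont (hu : IsLadder k u) (m : ℕ) (hm : m < 2 * k) :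
    C (u (m + 1)) * ((X ^ 2 - 1) * derivative (cont u 1 (m + 1)) -
      C (m : F) * X * cont u 1 (m + 1)) = -C (2 * k - 2 * m - 1 : F) * cont u 1 m := by
  induction m using Nat.strong_induction_on with
  | _ m ih =>
    match m with
    | 0 => simp [cont_zero, cont_one]
    | 1 =>
      have h := hu.mul_eq 1 le_rfl hm
      have h' : u 2 * u 1 = 2 * k - 2 * (1 : ℕ) - 1 := by
        apply mul_right_cancel₀ hu.two_mul_sub_one_ne_zero
        push_cast at h ⊢
        linear_combination h
      rw [← h', cont_add_two]
      simp only [derivative_mul, derivative_C, derivative_X, map_mul, zero_add, cont_one,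
        cont_zero, derivative_one, Nat.cast_one, map_one, add_zero]
      ring
    | m + 2 =>
      have h0 := ih m (by omega) (by omega)
      have h1 := ih (m + 1) (by omega) (by omega)
      have h := cont_ladder_step (k := k) m h0 (by
        rw [show (2 * k - 2 * m - 3 : F) = 2 * k - 2 * (m + 1 : ℕ) - 1 by push_cast; ring]
        exact_mod_cast h1)
      have hc1 := hu.mul_eq (m + 1) (by omega) (by omega)
      have hc2 := hu.mul_eq (m + 2) (by omega) (by omega)
      have hn := hu.mul_sub_ne_zero (m + 1) (by omega) (by omega)
      -- The product relations at m + 1 and m + 2 identify the coefficient produced by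
      -- `cont_ladder_step` with the expected one.
      have hc : u (m + 3) * (u (m + 1) * u (m + 2) + 2 * k - 2 * m - 1) =
          u (m + 1) * (2 * k - 2 * (m + 2 : ℕ) - 1) := by
        apply mul_right_cancel₀ (mul_ne_zero (hu.ne_zero (m + 2) (by omega) (by omega)) hn)
        push_cast at hc1 hc2 ⊢
        linear_combination
          (u (m + 3) * u (m + 2) - (2 * k - 2 * (m + 2 : F) - 1)) * hc1 +
            (2 * k - 2 * m - 1) * hc2
      apply mul_left_cancel₀ (C_ne_zero.2 (hu.ne_zero (m + 1) (by omega) (by omega)))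
      have hc' := congrArg C hc
      rw [C_mul, C_mul] at hc'
      push_cast at h ⊢
      push_cast at hc'
      linear_combination C (u (m + 3)) * h - cont u 1 (m + 2) * hc'

/-- At full length u_{2k-1} u_{2k} = 2k - 3 kills the lowering term, leaving the equation satisfied
by (X^2 - 1)^k. -/
theorem mul_derivative_cont_top (hu : IsLadder k u) (hk1 : 1 ≤ k) :
    (X ^ 2 - 1) * derivative (cont u 1 (2 * k + 1)) =
      C (2 * k : F) * X * cont u 1 (2 * k + 1) := by
  obtain ⟨m, hm⟩ : ∃ m, 2 * k = m + 2 := ⟨2 * k - 2, by omega⟩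
  have hmF : (2 * k : F) = m + 2 := by exact_mod_cast congrArg (Nat.cast : ℕ → F) hm
  have h0 := hu.mul_derivative_cont m (by omega)
  have h1 := hu.mul_derivative_cont (m + 1) (by omega)
  have h := cont_ladder_step (k := k) m h0 (by
    rw [show (2 * k - 2 * m - 3 : F) = 2 * k - 2 * (m + 1 : ℕ) - 1 by push_cast; ring]
    exact_mod_cast h1)
  have hc1 := hu.mul_eq (m + 1) (by omega) (by omega)
  have hn := hu.mul_sub_ne_zero (m + 1) (by omega) (by omega)
  have hz : u (m + 1) * u (m + 2) + 2 * k - 2 * m - 1 = 0 := by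
    apply mul_right_cancel₀ hn
    push_cast at hc1 ⊢
    rw [hmF] at hc1 ⊢
    linear_combination hc1
  rw [hz, C_0, neg_zero, zero_mul] at h
  have := (mul_eq_zero.1 h).resolve_left (C_ne_zero.2 (hu.ne_zero (m + 1) (by omega) (by omega)))
  rw [show 2 * k + 1 = m + 3 by omega, hmF]
  exact sub_eq_zero.1 this

/-- In the last lowering relation the two terms without derivative recombine, by the recurrence,
into the continuant of full length. -/
theorem mul_derivative_cont_penultimate (hu : IsLadder k u) (hk1 : 1 ≤ k) :
    C (u (2 * k)) * ((X ^ 2 - 1) * derivative (cont u 1 (2 * k))) =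
      C (2 * k - 1 : F) * cont u 1 (2 * k + 1) := by
  obtain ⟨m, hm⟩ : ∃ m, 2 * k = m + 2 := ⟨2 * k - 2, by omega⟩
  have hmF : (2 * k : F) = m + 2 := by exact_mod_cast congrArg (Nat.cast : ℕ → F) hm
  have h1 := hu.mul_derivative_cont (m + 1) (by omega)
  rw [hm, cont_add_two u 1 (m + 1), show 1 + (m + 1) = m + 2 by ring]
  rw [hmF] at h1 ⊢
  push_cast at h1 ⊢
  simp only [map_add, map_sub, map_mul, map_natCast, map_ofNat, map_one] at h1 ⊢
  linear_combination h1

end IsLadder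

end Ladder

/-! ### The polynomials P_k, R_k and the numbers w_i modulo p. -/

section PkPolynomials

open Polynomial

variable {p : ℕ} [Fact p.Prime] {k : ℕ}

theorem intCast_ne_zero_of_lt {z : ℤ} (h0 : z ≠ 0) (h1 : z < p) (h2 : -z < p) :
    (z : ZMod p) ≠ 0 := by
  rw [Ne, ZMod.intCast_zmod_eq_zero_iff_dvd]
  intro h
  exact h0 (Int.eq_zero_of_abs_lt_dvd h (abs_lt.2 ⟨by omega, h1⟩))

theorem natCast_ne_zero_of_lt {n : ℕ} (h0 : 0 < n) (h1 : n < p) : (n : ZMod p) ≠ 0 := by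
  have := intCast_ne_zero_of_lt (p := p) (z := n) (by omega) (by omega) (by omega)
  exact_mod_cast this

theorem eq_zero_of_derivative_eq_zero {f : (ZMod p)[X]} (hf : f.natDegree < p)
    (hd : derivative f = 0) (h0 : f.eval 0 = 0) : f = 0 := by
  ext n
  rw [coeff_zero]
  rcases le_or_gt p n with hn | hn
  · exact coeff_eq_zero_of_natDegree_lt (by omega)
  · cases n with
    | zero => rwa [coeff_zero_eq_eval_zero]
    | succ n =>
      have h := coeff_derivative f n
      rw [hd, coeff_zero] at h
      have hc := natCast_ne_zero_of_lt (p := p) (Nat.succ_pos n) hn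
      push_cast at hc
      exact (mul_eq_zero.1 h.symm).resolve_right hc

/-- Comparing coefficients gives f_1 = 0 and (n + 1) f_{n+1} = (n - 1 - c) f_{n-1}. In degrees below
p the factor n + 1 is invertible, so f_0 determines f. -/
theorem eq_zero_of_mul_derivative {f : (ZMod p)[X]} (hf : f.natDegree < p) (c : ZMod p)
    (hd : (X ^ 2 - 1) * derivative f = C c * X * f) (h0 : f.eval 0 = 0) : f = 0 := by
  have key : ∀ n < p, f.coeff n = 0 := by
    intro n
    induction n using Nat.strong_induction_on with
    | _ n ih =>
      intro hn
      match n with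
      | 0 => rwa [coeff_zero_eq_eval_zero]
      | 1 =>
        have := congrArg (fun g => coeff g 0) hd
        simpa [sub_mul, coeff_derivative, mul_assoc, pow_two] using this
      | 2 =>
        have := congrArg (fun g => coeff g 1) hd
        have h2 := natCast_ne_zero_of_lt (p := p) (n := 2) (by omega) hn
        simp [sub_mul, coeff_derivative, mul_assoc, pow_two, ih 0 (by omega) (by omega),
          coeff_X_mul] at this
        exact this.resolve_right (by rwa [one_add_one_eq_two])
      | n + 3 =>
        have := congrArg (fun g => coeff g (n + 2)) hd
        have h2 := natCast_ne_zero_of_lt (p := p) (n := n + 3) (by omega) hn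
        simp [sub_mul, coeff_derivative, mul_assoc, pow_two, ih (n + 1) (by omega) (by omega),
          coeff_X_mul] at this
        refine this.resolve_right ?_
        push_cast at h2
        rwa [add_assoc, two_add_one_eq_three]
  ext n
  rw [coeff_zero]
  rcases le_or_gt p n with hn | hn
  · exact coeff_eq_zero_of_natDegree_lt (by omega)
  · exact key n hn

theorem two_mul_half (hp : p ≠ 2) : 2 * ((p - 1) / 2) + 1 = p := by
  have := (Fact.out : p.Prime).eq_two_or_odd
  omega

/-- Modulo p the number (p - 1)/2 is -1/2. -/
theorem choose_half_succ (hp : p ≠ 2) {i : ℕ} (hi : 2 * i < p) :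
    (((p - 1) / 2).choose (i + 1) : ZMod p) * (2 * (i + 1)) =
      -((((p - 1) / 2).choose i : ZMod p) * (2 * i + 1)) := by
  have h := two_mul_half hp
  have h1 := Nat.choose_succ_right_eq ((p - 1) / 2) i
  obtain ⟨d, hd⟩ : ∃ d, (p - 1) / 2 = i + d := Nat.exists_eq_add_of_le (by omega)
  rw [show (p - 1) / 2 - i = d by omega] at h1
  have h1' := congrArg (Nat.cast : ℕ → ZMod p) h1
  have h2 : ((2 * (i + d) + 1 : ℕ) : ZMod p) = 0 := by
    rw [← hd, h, ZMod.natCast_self]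
  push_cast at h1' h2
  linear_combination 2 * h1' + (((p - 1) / 2).choose i : ZMod p) * h2

theorem choose_half_ne_zero (hp : p ≠ 2) {i : ℕ} (hi : 2 * i < p) :
    (((p - 1) / 2).choose i : ZMod p) ≠ 0 := by
  have h := two_mul_half hp
  rw [Ne, ZMod.natCast_eq_zero_iff]
  intro hd
  have hpp : p.Prime := Fact.out
  have h1 := (Nat.choose_mul_factorial_mul_factorial (show i ≤ (p - 1) / 2 by omega))
  have h2 : p ∣ ((p - 1) / 2).factorial := by
    rw [← h1, mul_assoc]
    exact hd.mul_right _
  have := (hpp.dvd_factorial).1 h2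
  omega

theorem omega_eq (hp : p ≠ 2) (hk : 1 ≤ k) (hkp : 2 * k < p) :
    omega p k = -(((p - 1) / 2).choose k : ZMod p) := by
  have key : ∀ n, 2 * n < p → (((p - 1) / 2).choose n : ZMod p) =
      (-1) ^ n * ∏ i ∈ Finset.Icc 1 n, (1 - 1 / (2 * (i : ZMod p))) := by
    intro n
    induction n with
    | zero => simp
    | succ n ih =>
      intro hn
      have h2 : (2 * (n + 1) : ZMod p) ≠ 0 := by
        have := natCast_ne_zero_of_lt (p := p) (n := 2 * (n + 1)) (by omega) hn
        push_cast at this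
        exact this
      have h := choose_half_succ hp (i := n) (by omega)
      rw [ih (by omega)] at h
      rw [Finset.prod_Icc_succ_top (by omega)]
      apply mul_right_cancel₀ h2
      rw [h]
      push_cast
      have e : (1 - 1 / (2 * ((n : ZMod p) + 1))) * (2 * (n + 1)) = 2 * n + 1 := by
        rw [sub_mul, div_mul_cancel₀ _ h2]
        ring
      linear_combination (-(-1) ^ (n + 1) *
        ∏ i ∈ Finset.Icc 1 n, (1 - 1 / (2 * (i : ZMod p)))) * e
  rw [key k hkp, omega]
  obtain ⟨m, rfl⟩ : ∃ m, k = m + 1 := ⟨k - 1, by omega⟩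
  rw [Nat.add_sub_cancel]
  ring

theorem omega_ne_zero (hp : p ≠ 2) (hk : 1 ≤ k) (hkp : 2 * k < p) : omega p k ≠ 0 := by
  rw [omega_eq hp hk hkp]
  exact neg_ne_zero.2 (choose_half_ne_zero hp hkp)

theorem two_mul_sub_one_ne_zero (hk : 1 ≤ k) (hkp : 2 * k < p) : (2 * k - 1 : ZMod p) ≠ 0 := by
  have := intCast_ne_zero_of_lt (p := p) (z := 2 * k - 1) (by omega) (by omega) (by omega)
  push_cast at this
  exact this

theorem odd_ne_zero (hkp : 2 * k < p) {i : ℕ} (hi : i < 2 * k) :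
    (2 * k - 2 * i - 1 : ZMod p) ≠ 0 := by
  have := intCast_ne_zero_of_lt (p := p) (z := 2 * k - 2 * i - 1) (by omega) (by omega) (by omega)
  push_cast at this
  exact this

theorem odd_ne_zero' (hkp : 2 * k < p) {i : ℕ} (h1 : 1 ≤ i) (hi : i ≤ 2 * k) :
    (2 * k - 2 * i + 1 : ZMod p) ≠ 0 := by
  have := intCast_ne_zero_of_lt (p := p) (z := 2 * k - 2 * i + 1) (by omega) (by omega) (by omega)
  push_cast at this
  exact this

theorem mul_sub_ne_zero (hkp : 2 * k < p) {i : ℕ} (h1 : 1 ≤ i) (hi : i < 2 * k) :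
    (i * (2 * k - i) : ZMod p) ≠ 0 := by
  have h := natCast_ne_zero_of_lt (p := p) (n := i) (by omega) (by omega)
  have := intCast_ne_zero_of_lt (p := p) (z := 2 * k - i) (by omega) (by omega) (by omega)
  push_cast at this
  exact mul_ne_zero h this

theorem w_one_mul (hp : p ≠ 2) (hk : 1 ≤ k) (hkp : 2 * k < p) :
    w p k 1 * (((p - 1) / 2).choose (k - 1) : ZMod p) = 1 := by
  have h1 := two_mul_sub_one_ne_zero hk hkp
  have h2 := omega_ne_zero hp hk hkp
  have h3 : (2 * k : ZMod p) ≠ 0 := by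
    have := natCast_ne_zero_of_lt (p := p) (n := 2 * k) (by omega) hkp
    push_cast at this
    exact this
  have h := choose_half_succ hp (i := k - 1) (by omega)
  have hc : ((k - 1 : ℕ) : ZMod p) = k - 1 := by push_cast [hk]; rfl
  have e : 2 * k * omega p k = (2 * k - 1) * (((p - 1) / 2).choose (k - 1) : ZMod p) := by
    rw [omega_eq hp hk hkp]
    rw [show k - 1 + 1 = k by omega, hc] at h
    linear_combination -h
  rw [w, div_mul_eq_mul_div, ← e, div_self (mul_ne_zero h3 h2)]

theorem w_ne_zero (hp : p ≠ 2) (hk : 1 ≤ k) (hkp : 2 * k < p) (i : ℕ) (h1 : 1 ≤ i)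
    (hi : i ≤ 2 * k) : w p k i ≠ 0 := by
  induction i, h1 using Nat.le_induction with
  | base => exact left_ne_zero_of_mul_eq_one (w_one_mul hp hk hkp)
  | succ i h1 ih =>
    obtain ⟨m, rfl⟩ : ∃ m, i = m + 1 := ⟨i - 1, by omega⟩
    rw [w]
    exact div_ne_zero (div_ne_zero (mul_ne_zero (odd_ne_zero hkp (by omega))
      (odd_ne_zero' hkp h1 (by omega))) (mul_sub_ne_zero hkp h1 (by omega))) (ih (by omega))

theorem w_mul (hp : p ≠ 2) (hk : 1 ≤ k) (hkp : 2 * k < p) (i : ℕ) (h1 : 1 ≤ i)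
    (hi : i < 2 * k) : w p k (i + 1) * w p k i * (i * (2 * k - i)) =
      (2 * k - 2 * i - 1) * (2 * k - 2 * i + 1) := by
  have h0 := w_ne_zero hp hk hkp i h1 hi.le
  have h2 := mul_sub_ne_zero hkp h1 hi
  obtain ⟨m, rfl⟩ : ∃ m, i = m + 1 := ⟨i - 1, by omega⟩
  rw [w, div_mul_cancel₀ _ h0, div_mul_cancel₀ _ h2]

theorem isLadder_w (hp : p ≠ 2) (hk : 1 ≤ k) (hkp : 2 * k < p) : IsLadder k (w p k) where
  mul_eq := w_mul hp hk hkp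
  ne_zero := w_ne_zero hp hk hkp
  two_mul_sub_one_ne_zero := two_mul_sub_one_ne_zero hk hkp
  mul_sub_ne_zero _ h1 h2 := mul_sub_ne_zero hkp h1 h2

/-- The product relation is invariant under i ↦ 2k - i. This much is available before the
antisymmetry `w_reverse`, whose proof depends on it. -/
theorem isLadder_reverse (hp : p ≠ 2) (hk : 1 ≤ k) (hkp : 2 * k < p) :
    IsLadder k (fun i => w p k (2 * k + 1 - i)) where
  mul_eq i h1 h2 := by
    have h := w_mul hp hk hkp (2 * k - i) (by omega) (by omega)
    rw [show 2 * k + 1 - (i + 1) = 2 * k - i by omega, show 2 * k + 1 - i = 2 * k - i + 1 by omega]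
    push_cast [h2.le] at h
    linear_combination h
  ne_zero i h1 h2 := w_ne_zero hp hk hkp _ (by omega) (by omega)
  two_mul_sub_one_ne_zero := two_mul_sub_one_ne_zero hk hkp
  mul_sub_ne_zero _ h1 h2 := mul_sub_ne_zero hkp h1 h2

/-- The sum `T ∑_{i < n} binom((p - 1) / 2, i) (T ^ 2 - 1) ^ i`, equal to `R_n`. -/
def binomialSum (p n : ℕ) : (ZMod p)[X] :=
  X * ∑ i ∈ Finset.range n, C (((p - 1) / 2).choose i : ZMod p) * (X ^ 2 - 1) ^ i

theorem binomialSum_succ (p n : ℕ) : binomialSum p (n + 1) =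
    binomialSum p n + C (((p - 1) / 2).choose n : ZMod p) * X * (X ^ 2 - 1) ^ n := by
  rw [binomialSum, Finset.sum_range_succ, binomialSum]
  ring

theorem natDegree_X_sq_sub_one : (X ^ 2 - 1 : (ZMod p)[X]).natDegree = 2 := by
  rw [← C_1]
  exact natDegree_X_pow_sub_C

theorem monic_P : (P p k).Monic := by
  rw [P, ← C_1]
  exact (monic_X_pow_sub_C _ two_ne_zero).pow k

theorem natDegree_P : (P p k).natDegree = 2 * k := by
  rw [P, natDegree_pow, natDegree_X_sq_sub_one, mul_comm]

theorem natDegree_binomialSum_le (n : ℕ) : (binomialSum p (n + 1)).natDegree ≤ 2 * n + 1 := by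
  rw [binomialSum, add_comm (2 * n)]
  refine natDegree_mul_le_of_le natDegree_X_le (natDegree_sum_le_of_forall_le _ _ fun i hi => ?_)
  refine (natDegree_C_mul_le _ _).trans ?_
  rw [natDegree_pow, natDegree_X_sq_sub_one]
  have := Finset.mem_range.1 hi
  omega

theorem X_pow_eq_binomialSum (hp : p ≠ 2) :
    (X ^ p : (ZMod p)[X]) = binomialSum p ((p - 1) / 2 + 1) := by
  have e : (X ^ p : (ZMod p)[X]) = X * ((X ^ 2 - 1) + 1) ^ ((p - 1) / 2) := by
    rw [sub_add_cancel, ← pow_mul, ← pow_succ', two_mul_half hp]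
  rw [e, add_pow, binomialSum]
  congr 1
  apply Finset.sum_congr rfl
  intro i _
  rw [one_pow, mul_one, mul_comm, C_eq_natCast]

/-- Expand T^p = T((T^2 - 1) + 1)^((p-1)/2): the terms with i ≥ k are divisible by P_k, and the
others have degree below 2k. -/
theorem R_eq (hp : p ≠ 2) (hk : 1 ≤ k) (hkp : 2 * k < p) : R p k = binomialSum p k := by
  have h := two_mul_half hp
  have hd : ∀ m, P p k ∣ binomialSum p (k + m) - binomialSum p k := by
    intro m
    induction m with
    | zero => simp
    | succ m ih =>
      rw [← add_assoc, binomialSum_succ, add_sub_right_comm]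
      refine dvd_add ih (Dvd.dvd.mul_left ?_ _)
      rw [P, pow_add]
      exact dvd_mul_right _ _
  have hd' := hd ((p - 1) / 2 + 1 - k)
  rw [show k + ((p - 1) / 2 + 1 - k) = (p - 1) / 2 + 1 by omega, ← X_pow_eq_binomialSum hp] at hd'
  rw [R, ← sub_add_cancel (X ^ p) (binomialSum p k), add_mod, EuclideanDomain.mod_eq_zero.2 hd',
    zero_add, mod_eq_self_iff monic_P.ne_zero]
  apply degree_lt_degree
  rw [natDegree_P]
  obtain ⟨m, rfl⟩ : ∃ m, k = m + 1 := ⟨k - 1, by omega⟩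
  have := natDegree_binomialSum_le (p := p) m
  omega

/-- The derivative of T(T^2 - 1)^n is (2n + 1)(T^2 - 1)^n + 2n(T^2 - 1)^(n-1), so `choose_half_succ`
makes the sum telescope. -/
theorem derivative_binomialSum (hp : p ≠ 2) (n : ℕ) (hn : 2 * n < p) :
    derivative (binomialSum p (n + 1)) =
      C ((2 * n + 1) * (((p - 1) / 2).choose n : ZMod p)) * (X ^ 2 - 1) ^ n := by
  induction n with
  | zero => simp [binomialSum]
  | succ n ih =>
    rw [binomialSum_succ, derivative_add, ih (by omega)]
    have h := congrArg C (choose_half_succ hp (i := n) (by omega))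
    simp only [derivative_mul, derivative_natCast, derivative_X, derivative_pow, derivative_sub,
      derivative_one, C_mul, C_add, C_neg, map_ofNat, map_natCast, map_one, Nat.add_sub_cancel,
      Nat.cast_add, Nat.cast_one, Nat.cast_ofNat] at h ⊢
    linear_combination (X ^ 2 - 1) ^ n * h

theorem derivative_R (hp : p ≠ 2) (hk : 1 ≤ k) (hkp : 2 * k < p) : derivative (R p k) =
    C ((2 * k - 1) * (((p - 1) / 2).choose (k - 1) : ZMod p)) * (X ^ 2 - 1) ^ (k - 1) := by
  rw [R_eq hp hk hkp]
  obtain ⟨m, rfl⟩ : ∃ m, k = m + 1 := ⟨k - 1, by omega⟩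
  rw [derivative_binomialSum hp m (by omega), Nat.add_sub_cancel]
  congr 2
  push_cast
  ring

theorem natDegree_R_lt (hp : p ≠ 2) (hk : 1 ≤ k) (hkp : 2 * k < p) :
    (R p k).natDegree < 2 * k := by
  rw [R_eq hp hk hkp]
  obtain ⟨m, rfl⟩ : ∃ m, k = m + 1 := ⟨k - 1, by omega⟩
  have := natDegree_binomialSum_le (p := p) m
  omega

theorem eval_zero_R (hp : p ≠ 2) (hk : 1 ≤ k) (hkp : 2 * k < p) : (R p k).eval 0 = 0 := by
  rw [R_eq hp hk hkp, binomialSum]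
  simp

theorem eval_one_R (hp : p ≠ 2) (hk : 1 ≤ k) (hkp : 2 * k < p) : (R p k).eval 1 = 1 := by
  rw [R_eq hp hk hkp, binomialSum]
  obtain ⟨m, rfl⟩ : ∃ m, k = m + 1 := ⟨k - 1, by omega⟩
  simp [eval_finsetSum, Finset.sum_range_succ']

theorem eval_zero_P : (P p k).eval 0 = (-1) ^ k := by simp [P]

theorem eval_one_P (hk : 1 ≤ k) : (P p k).eval 1 = 0 := by
  simp [P, Nat.one_le_iff_ne_zero.1 hk]

theorem mul_derivative_P : (X ^ 2 - 1) * derivative (P p k) = C (2 * k : ZMod p) * X * P p k := by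
  rcases Nat.eq_zero_or_pos k with rfl | hk
  · simp [P]
  · obtain ⟨m, rfl⟩ : ∃ m, k = m + 1 := ⟨k - 1, by omega⟩
    simp [P, derivative_pow]
    ring

/-- Both sides solve the same first-order equation, have degree below p and agree at 0. -/
theorem IsLadder.cont_top (hk : 1 ≤ k) (hkp : 2 * k < p) {u : ℕ → ZMod p} (hu : IsLadder k u) :
    cont u 1 (2 * k + 1) = (-1) ^ k * P p k := by
  rw [← sub_eq_zero]
  apply eq_zero_of_mul_derivative (p := p) (c := 2 * k)
  · refine (natDegree_sub_le_of_le (natDegree_cont_le u 1 (2 * k)) (n := 2 * k) ?_).trans_lt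
      (by simpa using hkp)
    rw [← C_1, ← C_neg, ← C_pow]
    exact (natDegree_C_mul_le _ _).trans natDegree_P.le
  · have h1 := hu.mul_derivative_cont_top hk
    have h2 := mul_derivative_P (p := p) (k := k)
    have h3 : derivative ((-1) ^ k * P p k) = (-1) ^ k * derivative (P p k) := by
      rw [← C_1, ← C_neg, ← C_pow, derivative_C_mul]
    rw [derivative_sub, h3]
    linear_combination h1 - (-1) ^ k * h2
  · rw [eval_sub, (eval_zero_cont u 1 k).2, eval_mul, eval_zero_P]
    simp [← mul_pow]

/-- Both sides vanish at 0 and have the same derivative, a multiple of (X^2 - 1)^(k-1). The number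
w_1 appears for every ladder u because it normalizes the derivative of R_k (`w_one_mul`). -/
theorem IsLadder.cont_penultimate (hp : p ≠ 2) (hk : 1 ≤ k) (hkp : 2 * k < p) {u : ℕ → ZMod p}
    (hu : IsLadder k u) : C (u (2 * k)) * cont u 1 (2 * k) = (-1) ^ k * C (w p k 1) * R p k := by
  rw [← sub_eq_zero]
  have hs : ((-1) ^ k : (ZMod p)[X]) = C ((-1) ^ k) := by simp
  apply eq_zero_of_derivative_eq_zero (p := p)
  · refine (natDegree_sub_le_of_le (m := 2 * k) (n := 2 * k) ?_ ?_).trans_lt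
      (by simpa using hkp)
    · obtain ⟨m, hm⟩ : ∃ m, 2 * k = m + 1 := ⟨2 * k - 1, by omega⟩
      rw [hm]
      exact (natDegree_C_mul_le _ _).trans ((natDegree_cont_le u 1 m).trans (Nat.le_succ m))
    · rw [hs, ← C_mul]
      exact (natDegree_C_mul_le _ _).trans (natDegree_R_lt hp hk hkp).le
  · have h1 := hu.mul_derivative_cont_penultimate hk
    rw [hu.cont_top hk hkp, P] at h1
    have h0 : (X ^ 2 - 1 : (ZMod p)[X]) ≠ 0 := ne_zero_of_natDegree_gt
      (n := 0) (by rw [natDegree_X_sq_sub_one]; norm_num)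
    have h2 := congrArg C (w_one_mul hp hk hkp)
    obtain ⟨m, rfl⟩ : ∃ m, k = m + 1 := ⟨k - 1, by omega⟩
    apply mul_left_cancel₀ h0
    rw [derivative_sub, hs, ← C_mul, derivative_C_mul, derivative_C_mul, derivative_R hp hk hkp]
    rw [hs] at h1
    simp only [C_mul, C_1, Nat.add_sub_cancel] at h1 h2 ⊢
    linear_combination h1 - C ((-1) ^ (m + 1)) * C (2 * ((m + 1 : ℕ) : ZMod p) - 1) *
      (X ^ 2 - 1) ^ (m + 1) * h2
  · rw [eval_sub, eval_mul, (eval_zero_cont u 1 k).1, eval_mul, eval_zero_R hp hk hkp]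
    simp

theorem cont_two_top (hp : p ≠ 2) (hk : 1 ≤ k) (hkp : 2 * k < p) :
    cont (w p k) 2 (2 * k) = (-1) ^ k * R p k := by
  have h := (isLadder_reverse hp hk hkp).cont_penultimate hp hk hkp
  obtain ⟨m, hm⟩ : ∃ m, 2 * k = m + 1 := ⟨2 * k - 1, by omega⟩
  have e : cont (fun i => w p k (2 * k + 1 - i)) 1 (2 * k) = cont (w p k) 2 (2 * k) := by
    rw [hm]
    apply cont_eq_of_reverse
    intro i hi
    apply congrArg (w p k)
    omega
  rw [e, show 2 * k + 1 - 2 * k = 1 by omega] at h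
  apply mul_left_cancel₀ (C_ne_zero.2 (w_ne_zero hp hk hkp 1 le_rfl (by omega)))
  linear_combination h

/-- At T = 1, where P_k vanishes and R_k is 1, the determinant identity compares the penultimate
continuants of w and of the reversed word. -/
theorem w_top (hp : p ≠ 2) (hk : 1 ≤ k) (hkp : 2 * k < p) : w p k (2 * k) = -w p k 1 := by
  have h1 := congrArg (eval 1) ((isLadder_w hp hk hkp).cont_penultimate hp hk hkp)
  have h2 := congrArg (eval 1) (cont_two_top hp hk hkp)
  have h3 := congrArg (eval 1) ((isLadder_w hp hk hkp).cont_top hk hkp)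
  obtain ⟨m, hm⟩ : ∃ m, 2 * k = m + 1 := ⟨2 * k - 1, by omega⟩
  have h4 := congrArg (eval 1) (cont_det (w p k) 1 m)
  rw [show m + 2 = 2 * k + 1 by omega, ← hm] at h4
  simp only [eval_mul, eval_sub, eval_pow, eval_neg, eval_one, eval_C, eval_one_R hp hk hkp,
    eval_one_P hk, pow_mul, neg_sq, one_pow, show (1 + 1 : ℕ) = 2 from rfl] at h1 h2 h3 h4
  have hs : ((-1) ^ k * (-1) ^ k : ZMod p) = 1 := by rw [← mul_pow]; simp
  rw [h3, h2] at h4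
  linear_combination (-(-1) ^ k) * h1 - (w p k (2 * k)) * h4 - w p k 1 * hs

theorem w_reverse (hp : p ≠ 2) (hk : 1 ≤ k) (hkp : 2 * k < p) (i : ℕ) (h1 : 1 ≤ i)
    (hi : i ≤ 2 * k) : w p k (2 * k + 1 - i) = -w p k i := by
  induction i, h1 using Nat.le_induction with
  | base => rw [Nat.add_sub_cancel, w_top hp hk hkp]
  | succ i h1 ih =>
    have ih := ih (by omega)
    have e1 := w_mul hp hk hkp i h1 (by omega)
    have e2 := w_mul hp hk hkp (2 * k - i) (by omega) (by omega)
    have hc : ((2 * k - i : ℕ) : ZMod p) = 2 * k - i := by push_cast [(by omega : i ≤ 2 * k)]; rfl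
    rw [show 2 * k - i + 1 = 2 * k + 1 - i by omega, ih, hc] at e2
    rw [show 2 * k + 1 - (i + 1) = 2 * k - i by omega]
    apply mul_right_cancel₀ (mul_ne_zero (w_ne_zero hp hk hkp i h1 (by omega))
      (mul_sub_ne_zero hkp h1 (by omega)))
    linear_combination -e2 + e1

/-- Reversing a word in the `w_i` changes all signs. -/
theorem cont_w_reverse (hp : p ≠ 2) (hk : 1 ≤ k) (hkp : 2 * k < p) {l n m : ℕ} (hn : 1 ≤ n)
    (hm : 1 ≤ m) (h : n + m + l = 2 * k + 2) :
    cont (w p k) n (l + 1) = (-1) ^ l * cont (w p k) m (l + 1) := by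
  rw [← cont_eq_of_reverse (w p k) (fun i => w p k (m + (l - 1 - (i - n)))) l m n]
  · apply cont_neg
    intro i hi
    rw [← w_reverse hp hk hkp _ (by omega) (by omega)]
    congr 1
    omega
  · intro i hi
    simp

theorem cont_one_penultimate (hp : p ≠ 2) (hk : 1 ≤ k) (hkp : 2 * k < p) :
    cont (w p k) 1 (2 * k) = -(-1) ^ k * R p k := by
  obtain ⟨m, rfl⟩ : ∃ m, k = m + 1 := ⟨k - 1, by omega⟩
  rw [show 2 * (m + 1) = 2 * m + 1 + 1 by ring,
    cont_w_reverse hp hk hkp (n := 1) (m := 2) le_rfl (by omega) (by omega),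
    show 2 * m + 1 + 1 = 2 * (m + 1) by ring, cont_two_top hp hk hkp, pow_succ, pow_mul]
  simp

end PkPolynomials

/-! ### Expansions as roots of H(V). -/

section Expansion

variable {p : ℕ} [Fact p.Prime] {k : ℕ}

theorem wContinuant_eq_cont (n l : ℕ) : wContinuant p k n l = cont (w p k) n (l + 1) := by
  induction l using Nat.strong_induction_on with
  | _ l ih =>
    match l with
    | 0 => rfl
    | 1 => simp [wContinuant, cont]
    | l + 2 =>
      rw [wContinuant, ih (l + 1) (by omega), ih l (by omega), cont_add_two _ _ (l + 1)]
      rfl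

theorem K_eq_cont (n m : ℕ) : K p k n m = cont (w p k) n (m + 2 - n) := by
  rw [K]
  split_ifs with h
  · rw [show m + 2 - n = 0 by omega, cont_zero]
  · rw [wContinuant_eq_cont, show m + 1 - n + 1 = m + 2 - n by omega]

theorem wWord_ne_zero (hp : p ≠ 2) (hk : 1 ≤ k) (hkp : 2 * k < p) {j : ℕ} {a : ZMod p}
    (ha : a ∈ wWord p k (j + 1) (2 * k)) : a ≠ 0 := by
  obtain ⟨i, hi, rfl⟩ := List.mem_map.1 ha
  obtain ⟨d, hd, rfl⟩ := List.mem_range'.1 hi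
  exact w_ne_zero hp hk hkp _ (by omega) (by omega)

theorem eval₂_H (j : ℕ) (ε : ZMod p) (x : (ZMod p)⸨X⸩) : (H p k j ε).eval₂ polyEmb x =
    polyEmb (K p k (j + 2) (2 * k)) * x ^ (p + 1) - polyEmb (K p k (j + 1) (2 * k)) * x ^ p +
      (polyEmb (Polynomial.C ε * K p k 1 j) * x +
        polyEmb (Polynomial.C ε * K p k 1 (j - 1))) := by
  simp only [H, Polynomial.eval₂_add, Polynomial.eval₂_sub, Polynomial.eval₂_mul,
    Polynomial.eval₂_C, Polynomial.eval₂_X, Polynomial.eval₂_X_pow, map_mul]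
  ring

/-- The equation `α ^ p = e (P_k α' - R_k)` in terms of `H(V)`. -/
theorem eval₂_H_eq_zero_iff (hp : p ≠ 2) (hk : 1 ≤ k) (hkp : 2 * k < p) {j : ℕ} (hj : 1 ≤ j)
    (hjk : j ≤ 2 * k - 1) (ε : ZMod p) {x y : (ZMod p)⸨X⸩}
    (h : x * (polyEmb (K p k (j + 2) (2 * k)) * y + polyEmb (K p k (j + 2) (2 * k - 1))) =
      polyEmb (K p k (j + 1) (2 * k)) * y + polyEmb (K p k (j + 1) (2 * k - 1))) :
    (polyEmb (K p k (j + 2) (2 * k)) * x - polyEmb (K p k (j + 1) (2 * k))) *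
      (polyEmb (K p k (j + 2) (2 * k)) * y + polyEmb (K p k (j + 2) (2 * k - 1))) =
        -(-1) ^ j ∧
    ((H p k j ε).eval₂ polyEmb x = 0 ↔
      x ^ p = polyEmb (Polynomial.C (ε * (-1) ^ (k + j)) * P p k) * y +
        polyEmb (Polynomial.C (-(ε * (-1) ^ (k + j))) * R p k)) := by
  obtain ⟨l, hl⟩ : ∃ l, 2 * k = j + l + 1 := ⟨2 * k - j - 1, by omega⟩
  have hA : K p k (j + 1) (2 * k) = cont (w p k) (j + 1) (l + 2) := by
    rw [K_eq_cont]; congr 1; omega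
  have hB : K p k (j + 1) (2 * k - 1) = cont (w p k) (j + 1) (l + 1) := by
    rw [K_eq_cont]; congr 1; omega
  have hC : K p k (j + 2) (2 * k) = cont (w p k) (j + 2) (l + 1) := by
    rw [K_eq_cont]; congr 1; omega
  have hD : K p k (j + 2) (2 * k - 1) = cont (w p k) (j + 2) l := by
    rw [K_eq_cont]; congr 1; omega
  have hE : K p k 1 j = cont (w p k) 1 (j + 1) := by rw [K_eq_cont]; congr 1
  have hG : K p k 1 (j - 1) = cont (w p k) 1 j := by rw [K_eq_cont]; congr 1; omega
  have hs : ((-1) ^ j : (ZMod p)[X]) = (-1) ^ (l + 1) := by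
    have : ((-1) ^ (2 * k) : (ZMod p)[X]) = 1 := by simp
    rw [hl, add_assoc, pow_add] at this
    calc ((-1) ^ j : (ZMod p)[X]) = (-1) ^ j * ((-1) ^ (l + 1) * (-1) ^ (l + 1)) := by
          rw [← mul_pow]; simp
      _ = _ := by rw [← mul_assoc, this, one_mul]
  -- The three inputs: the determinant of the Möbius map, and the full and penultimate continuants
  -- cut after the j-th entry.
  have hdet := congrArg polyEmb (cont_det (w p k) (j + 1) l)
  have hP := congrArg polyEmb (cont_add (w p k) 1 j (l + 1))
  have hR := congrArg polyEmb (cont_add (w p k) 1 j l)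
  rw [show j + (l + 1) + 1 = 2 * k + 1 by omega, (isLadder_w hp hk hkp).cont_top hk hkp] at hP
  rw [show j + l + 1 = 2 * k by omega, cont_one_penultimate hp hk hkp] at hR
  rw [← hs] at hdet
  rw [eval₂_H, hE, hG]
  rw [hA, hB, hC, hD] at h
  rw [hA, hC, hD]
  rw [show 1 + j = j + 1 by ring] at hP hR
  simp only [map_mul, map_add, map_sub, map_neg, map_pow, map_one] at hP hR hdet ⊢
  set a := polyEmb (cont (w p k) (j + 1) (l + 2))
  set b := polyEmb (cont (w p k) (j + 1) (l + 1))
  set c := polyEmb (cont (w p k) (j + 2) (l + 1))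
  set d := polyEmb (cont (w p k) (j + 2) l)
  set q := c * y + d with hq
  have h1 : (c * x - a) * q = -(-1) ^ j := by
    rw [hq] at h ⊢
    linear_combination c * h - hdet
  have hss : ((-1) ^ j * (-1) ^ j : (ZMod p)⸨X⸩) = 1 := by rw [← mul_pow]; simp
  have hq0 : q ≠ 0 := by
    intro h0
    rw [h0, mul_zero] at h1
    have : (-(-1) ^ j : (ZMod p)⸨X⸩) ≠ 0 := neg_ne_zero.2 (pow_ne_zero _ (by simp))
    exact this h1.symm
  refine ⟨h1, ?_⟩
  set e := polyEmb (cont (w p k) 1 (j + 1))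
  set g := polyEmb (cont (w p k) 1 j)
  set t := polyEmb (Polynomial.C ε)
  -- Since (c x - a) q is the constant -(-1)^j, the power x^p comes out with coefficient 1; the cut
  -- continuants turn the remaining terms into P_k and R_k.
  have h2 : (c * x ^ (p + 1) - a * x ^ p + (t * e * x + t * g)) * (q * -(-1) ^ j) =
      x ^ p - (t * (-1) ^ (k + j) * polyEmb (P p k) * y +
        -(t * (-1) ^ (k + j)) * polyEmb (R p k)) := by
    rw [pow_add]
    linear_combination (-x ^ p * (-1) ^ j) * h1 + x ^ p * hss - t * e * (-1) ^ j * h +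
      t * (-1) ^ j * y * hP + t * (-1) ^ j * hR
  rw [← sub_eq_zero (a := x ^ p), ← h2, mul_eq_zero, or_iff_left]
  exact mul_ne_zero hq0 (neg_ne_zero.2 (pow_ne_zero _ (by simp)))

/-- The coefficient of X^p has degree one more than that of X^(p+1), and the two low coefficients
have degree at most j < p, which fits `exists_unique_root`. -/
theorem exists_unique_root_H (hp : p ≠ 2) (hk : 1 ≤ k) (hkp : 2 * k < p) {j : ℕ} (hj : 1 ≤ j)
    (hjk : j ≤ 2 * k - 1) (ε : ZMod p) : ∃ x : (ZMod p)⸨X⸩, ∀ z : (ZMod p)⸨X⸩,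
      (z.order < 0 ∧ (H p k j ε).eval₂ polyEmb z = 0) ↔ z = x := by
  obtain ⟨l, hl⟩ : ∃ l, 2 * k = j + l + 1 := ⟨2 * k - j - 1, by omega⟩
  simp only [eval₂_H, K_eq_cont]
  rw [show 2 * k + 2 - (j + 2) = l + 1 by omega, show 2 * k + 2 - (j + 1) = l + 1 + 1 by omega,
    show j + 2 - 1 = j + 1 by omega, show j - 1 + 2 - 1 = j - 1 + 1 by omega]
  apply exists_unique_root (n := l) (m := p + l - 1) (by omega)
  · exact natDegree_cont fun i hi => w_ne_zero hp hk hkp _ (by omega) (by omega)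
  · exact natDegree_cont_le _ _ _
  · exact cont_ne_zero fun i hi => w_ne_zero hp hk hkp _ (by omega) (by omega)
  · omega
  · refine (Polynomial.natDegree_C_mul_le _ _).trans ((natDegree_cont_le _ _ _).trans ?_)
    omega
  · refine (Polynomial.natDegree_C_mul_le _ _).trans ((natDegree_cont_le _ _ _).trans ?_)
    omega

theorem order_polyEmb_mul_add {f g : (ZMod p)[X]} {x : (ZMod p)⸨X⸩} (hf : f ≠ 0)
    (hg : g = 0 ∨ g.natDegree ≤ f.natDegree) (hx : x.order < 0) :
    (polyEmb f * x + polyEmb g).order = -f.natDegree + x.order ∧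
      polyEmb f * x + polyEmb g ≠ 0 := by
  have h0 := ne_zero_of_order_neg hx
  have h := order_add_of_lt (x := polyEmb f * x) (y := polyEmb g)
    (mul_ne_zero (polyEmb_ne_zero hf) h0) (by
      rcases eq_or_ne g 0 with rfl | hg0
      · left; simp
      · right
        rw [HahnSeries.order_mul (polyEmb_ne_zero hf) h0, order_polyEmb hf, order_polyEmb hg0]
        have := hg.resolve_left hg0
        omega)
  rwa [HahnSeries.order_mul (polyEmb_ne_zero hf) h0, order_polyEmb hf] at h

theorem cfEval_wWord (hp : p ≠ 2) (hk : 1 ≤ k) (hkp : 2 * k < p) {j : ℕ} (hj : 1 ≤ j)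
    (hjk : j ≤ 2 * k - 1) {y : (ZMod p)⸨X⸩} (hy : y.order < 0) :
    cfEval (wWord p k (j + 1) (2 * k)) y *
      (polyEmb (K p k (j + 2) (2 * k)) * y + polyEmb (K p k (j + 2) (2 * k - 1))) =
      polyEmb (K p k (j + 1) (2 * k)) * y + polyEmb (K p k (j + 1) (2 * k - 1)) := by
  obtain ⟨l, hl⟩ : ∃ l, 2 * k = j + l + 1 := ⟨2 * k - j - 1, by omega⟩
  have := cfEval_mul_cont (w p k) l (j + 1)
    (fun i hi => w_ne_zero hp hk hkp _ (by omega) (by omega)) hy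
  rw [wWord, K_eq_cont, K_eq_cont, K_eq_cont, K_eq_cont]
  rwa [show 2 * k + 2 - (j + 2) = l + 1 by omega, show 2 * k - 1 + 2 - (j + 2) = l by omega,
    show 2 * k + 2 - (j + 1) = l + 2 by omega, show 2 * k - 1 + 2 - (j + 1) = l + 1 by omega,
    show 2 * k + 1 - (j + 1) = l + 1 by omega]

theorem isPkExpansion_iff (hp : p ≠ 2) (hk : 1 ≤ k) (hkp : 2 * k < p) {j : ℕ} (hj : 1 ≤ j)
    (hjk : j ≤ 2 * k - 1) {ε : ZMod p} (hε : ε ≠ 0) (x : (ZMod p)⸨X⸩) :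
    IsPkExpansion k (wWord p k (j + 1) (2 * k)) (ε * (-1) ^ (k + j)) (-(ε * (-1) ^ (k + j))) x ↔
      x.order < 0 ∧ (H p k j ε).eval₂ polyEmb x = 0 := by
  have hpp : p.Prime := Fact.out
  obtain ⟨l, hl⟩ : ∃ l, 2 * k = j + l + 1 := ⟨2 * k - j - 1, by omega⟩
  have hw : ∀ n, 1 ≤ n → ∀ i, n + i ≤ 2 * k → w p k (n + i) ≠ 0 := fun n hn i hi =>
    w_ne_zero hp hk hkp _ (by omega) hi
  have hlen : (wWord p k (j + 1) (2 * k)).length = l + 1 := by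
    rw [wWord, List.length_map, List.length_range']
    omega
  constructor
  · rintro ⟨hinf, -, -, -, hexp, hpow⟩
    have hx := eq_cfEval_completeQuotient _ _ hexp
    have hy := hinf.order_neg (wWord p k (j + 1) (2 * k)).length
    have h := cfEval_wWord hp hk hkp hj hjk hy
    rw [← hx] at h
    exact ⟨hinf.order_neg 0, (eval₂_H_eq_zero_iff hp hk hkp hj hjk ε h).2.2 hpow⟩
  · rintro ⟨hx, hroot⟩
    have hC0 : K p k (j + 2) (2 * k) ≠ 0 := by
      rw [K_eq_cont, show 2 * k + 2 - (j + 2) = l + 1 by omega]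
      exact cont_ne_zero fun i hi => hw _ (by omega) _ (by omega)
    have hCdeg : (K p k (j + 2) (2 * k)).natDegree = l := by
      rw [K_eq_cont, show 2 * k + 2 - (j + 2) = l + 1 by omega]
      exact natDegree_cont fun i hi => hw _ (by omega) _ (by omega)
    have hDdeg : (K p k (j + 2) (2 * k - 1)).natDegree ≤ l := by
      rw [K_eq_cont, show 2 * k - 1 + 2 - (j + 2) = l by omega]
      cases l with
      | zero => simp [cont_zero]
      | succ l => exact (natDegree_cont_le _ _ _).trans (Nat.le_succ l)
    have hroot' := hroot
    rw [eval₂_H] at hroot'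
    -- Otherwise the equation would leave ε(K_{1,j} x + K_{1,j-1}) = 0, which is impossible by
    -- degrees. Hence the Möbius map can be inverted to define the tail y.
    have hden : polyEmb (K p k (j + 2) (2 * k)) * x - polyEmb (K p k (j + 1) (2 * k)) ≠ 0 := by
      intro h0
      have h1 : polyEmb (Polynomial.C ε * K p k 1 j) * x +
          polyEmb (Polynomial.C ε * K p k 1 (j - 1)) = 0 := by
        linear_combination hroot' - x ^ p * h0
      refine (order_polyEmb_mul_add ?_ (Or.inr ?_) hx).2 h1
      · rw [K_eq_cont, show j + 2 - 1 = j + 1 by omega]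
        exact mul_ne_zero (Polynomial.C_ne_zero.2 hε)
          (cont_ne_zero fun i hi => hw _ (by omega) _ (by omega))
      · rw [Polynomial.natDegree_C_mul hε, Polynomial.natDegree_C_mul hε, K_eq_cont, K_eq_cont,
          show j + 2 - 1 = j + 1 by omega, show j - 1 + 2 - 1 = j - 1 + 1 by omega,
          natDegree_cont (l := j) fun i hi => hw _ (by omega) _ (by omega)]
        exact (natDegree_cont_le _ _ _).trans (by omega)
    obtain ⟨y, hy⟩ : ∃ y, y * (polyEmb (K p k (j + 2) (2 * k)) * x -
        polyEmb (K p k (j + 1) (2 * k))) = polyEmb (K p k (j + 1) (2 * k - 1)) -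
          polyEmb (K p k (j + 2) (2 * k - 1)) * x :=
      ⟨_, div_mul_cancel₀ _ hden⟩
    have hxy : x * (polyEmb (K p k (j + 2) (2 * k)) * y + polyEmb (K p k (j + 2) (2 * k - 1))) =
        polyEmb (K p k (j + 1) (2 * k)) * y + polyEmb (K p k (j + 1) (2 * k - 1)) := by
      linear_combination hy
    obtain ⟨hq, hiff⟩ := eval₂_H_eq_zero_iff hp hk hkp hj hjk ε hxy
    have hpow := hiff.1 hroot
    have he : ε * (-1) ^ (k + j) ≠ 0 := mul_ne_zero hε (pow_ne_zero _ (by simp))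
    -- The degree of x^p is at least p, beyond those of R_k and of P_k, so P_k y has larger degree
    -- than P_k.
    have hy0 : y.order < 0 := by
      have h1 : polyEmb (Polynomial.C (ε * (-1) ^ (k + j)) * P p k) * y =
          x ^ p + polyEmb (Polynomial.C (ε * (-1) ^ (k + j)) * R p k) := by
        rw [hpow]
        simp only [map_mul, map_neg]
        ring
      have hxp : (x ^ p).order = p * x.order := by rw [HahnSeries.order_pow]; simp
      have hxp' : (p : ℤ) * x.order ≤ -p := by nlinarith [hpp.pos]
      have h2 := order_add_of_lt (x := x ^ p)
        (y := polyEmb (Polynomial.C (ε * (-1) ^ (k + j)) * R p k))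
        (pow_ne_zero _ (ne_zero_of_order_neg hx)) (by
          rcases eq_or_ne (R p k) 0 with h0 | h0
          · left; simp [h0]
          · right
            rw [order_polyEmb (mul_ne_zero (Polynomial.C_ne_zero.2 he) h0),
              Polynomial.natDegree_C_mul he, hxp]
            have := natDegree_R_lt hp hk hkp
            omega)
      rw [← h1] at h2
      have hP0 : polyEmb (Polynomial.C (ε * (-1) ^ (k + j)) * P p k) ≠ 0 :=
        left_ne_zero_of_mul h2.2
      have h3 := h2.1
      rw [HahnSeries.order_mul hP0 (right_ne_zero_of_mul h2.2), order_polyEmb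
        (mul_ne_zero (Polynomial.C_ne_zero.2 he) monic_P.ne_zero), Polynomial.natDegree_C_mul he,
        natDegree_P, hxp] at h3
      push_cast at h3
      omega
    have hqorder := order_polyEmb_mul_add hC0 (Or.inr (hDdeg.trans hCdeg.ge)) hy0
    have hxcf : x = cfEval (wWord p k (j + 1) (2 * k)) y :=
      mul_right_cancel₀ hqorder.2 (hxy.trans (cfEval_wWord hp hk hkp hj hjk hy0).symm)
    have hwn : ∀ a ∈ wWord p k (j + 1) (2 * k), a ≠ 0 := fun a ha => wWord_ne_zero hp hk hkp ha
    -- Let x = U/V in lowest terms and W = V(K_{j+2,2k} x - K_{j+1,2k}). The bracket times a series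
    -- of positive degree is ±1, so deg W < deg V. Clearing denominators in H(V)(x) = 0 gives V^p ∣
    -- U^p W, hence V^p ∣ W, against the degrees.
    have hirr : ¬ IsRational x := by
      intro hrat
      obtain ⟨U, V, hV, hcop, hUV⟩ := hrat.coprime
      have hW : (polyEmb (K p k (j + 2) (2 * k)) * x - polyEmb (K p k (j + 1) (2 * k))) *
          polyEmb V = polyEmb (K p k (j + 2) (2 * k) * U - K p k (j + 1) (2 * k) * V) := by
        rw [map_sub, map_mul, map_mul, ← hUV]
        ring
      set W := K p k (j + 2) (2 * k) * U - K p k (j + 1) (2 * k) * V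
      have hW0 : W ≠ 0 := by
        intro h0
        rw [h0, map_zero] at hW
        exact mul_ne_zero hden (polyEmb_ne_zero hV) hW
      have hdeg : W.natDegree < V.natDegree := by
        have h1 := congrArg HahnSeries.order hW
        rw [HahnSeries.order_mul hden (polyEmb_ne_zero hV), order_polyEmb hV,
          order_polyEmb hW0] at h1
        have h2 := congrArg HahnSeries.order hq
        rw [HahnSeries.order_mul hden hqorder.2, hqorder.1, HahnSeries.order_neg,
          HahnSeries.order_pow, HahnSeries.order_neg, HahnSeries.order_one, smul_zero] at h2
        omega
      have hdvd : V ^ p ∣ U ^ p * W := by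
        refine ⟨-(Polynomial.C ε * K p k 1 j * U + Polynomial.C ε * K p k 1 (j - 1) * V), ?_⟩
        apply polyEmb_injective
        rw [map_mul, map_mul, ← hW]
        simp only [map_neg, map_add, map_mul, map_pow] at hroot' ⊢
        rw [← hUV]
        linear_combination polyEmb V ^ (p + 1) * hroot'
      have hle := Polynomial.natDegree_le_of_dvd
        ((hcop.symm.pow (m := p) (n := p)).dvd_of_dvd_mul_left hdvd) hW0
      rw [Polynomial.natDegree_pow] at hle
      have := Nat.le_mul_of_pos_left V.natDegree hpp.pos
      omega
    refine ⟨isInfiniteCF_of_not_isRational hx hirr, ?_, hwn, he, ?_, ?_⟩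
    · rw [← List.length_pos_iff, hlen]
      exact Nat.succ_pos l
    · intro i hi
      conv_lhs => rw [hxcf]
      exact partialQuotient_cfEval hwn hy0 i hi
    · have : completeQuotient x (wWord p k (j + 1) (2 * k)).length = y := by
        conv_lhs => rw [hxcf]
        rw [completeQuotient_cfEval hwn hy0 _ le_rfl, List.drop_length, cfEval_nil]
      rw [this]
      exact hpow

end Expansion

/-! ### Finite continued fractions with constant entries. -/

section FiniteCF

variable {F : Type*} [Field F]

theorem finCF_cons (x : F) (l : List F) : finCF (x :: l) = x + (finCF l)⁻¹ := rfl

theorem finCF_singleton (x : F) : finCF [x] = x := by simp [finCF]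

theorem finCFDefined_cons (x : F) {l : List F} (hl : l ≠ []) :
    FinCFDefined (x :: l) ↔ FinCFDefined l ∧ finCF l ≠ 0 := by
  cases l with
  | nil => exact absurd rfl hl
  | cons y l => rfl

theorem finCF_append_pair (l : List F) (b c : F) :
    finCF (l ++ [b, c]) = finCF (l ++ [b + c⁻¹]) := by
  induction l with
  | nil => simp [finCF]
  | cons x l ih => rw [List.cons_append, List.cons_append, finCF_cons, finCF_cons, ih]

theorem finCFDefined_append_pair (l : List F) {b c : F} (hc : c ≠ 0) :
    FinCFDefined (l ++ [b, c]) ↔ FinCFDefined (l ++ [b + c⁻¹]) := by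
  induction l with
  | nil => simp [FinCFDefined, finCF, hc]
  | cons x l ih =>
    rw [List.cons_append, List.cons_append, finCFDefined_cons x (by simp),
      finCFDefined_cons x (by simp), ih, finCF_append_pair]

end FiniteCF

/-! ### Perfect expansions and the symmetry j ↦ 2k - j. -/

section Perfect

variable {p : ℕ} [Fact p.Prime] {k : ℕ}

theorem wWord_succ {n m : ℕ} (h : n ≤ m) : wWord p k n m = w p k n :: wWord p k (n + 1) m := by
  rw [wWord, show m + 1 - n = m + 1 - (n + 1) + 1 by omega, List.range'_succ]
  rfl

theorem wWord_empty {n m : ℕ} (h : m < n) : wWord p k n m = [] := by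
  rw [wWord, show m + 1 - n = 0 by omega]
  rfl

/-- Descending induction from j = 2k - 1. The suffix t is [ω_k] for type A and empty for type B. -/
theorem finCF_wWord_append (t : List (ZMod p)) (v : ℕ → ZMod p)
    (htop : finCF (w p k (2 * k) :: t) = v (2 * k - 1))
    (hdef : FinCFDefined (w p k (2 * k) :: t))
    (hv0 : ∀ j, 1 ≤ j → j ≤ 2 * k - 1 → v j ≠ 0)
    (hv : ∀ j, 1 ≤ j → j < 2 * k - 1 → v j = w p k (j + 1) + (v (j + 1))⁻¹)
    (d : ℕ) : ∀ j, 1 ≤ j → j + d = 2 * k - 1 →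
      finCF (wWord p k (j + 1) (2 * k) ++ t) = v j ∧
        FinCFDefined (wWord p k (j + 1) (2 * k) ++ t) := by
  induction d with
  | zero =>
    intro j h1 hj
    rw [wWord_succ (by omega), wWord_empty (by omega), show j + 1 = 2 * k by omega,
      show j = 2 * k - 1 by omega]
    exact ⟨htop, hdef⟩
  | succ d ih =>
    intro j h1 hj
    obtain ⟨e1, e2⟩ := ih (j + 1) (by omega) (by omega)
    rw [wWord_succ (by omega), List.cons_append, finCF_cons, e1, hv j h1 (by omega),
      finCFDefined_cons _ (by rw [wWord_succ (by omega)]; simp), e1]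
    exact ⟨rfl, e2, hv0 _ (by omega) (by omega)⟩

/-- The last entry w_{j+1} - v_j equals -1/v_{j+1}. Absorbing it into its neighbour gives w_{j+2} -
v_{j+1}, the same situation for j + 1, so the fraction telescopes. -/
theorem finCF_shiftedReverse (v : ℕ → ZMod p)
    (hv0 : ∀ j, 1 ≤ j → j ≤ 2 * k - 1 → v j ≠ 0)
    (hv : ∀ j, 1 ≤ j → j < 2 * k - 1 → v j = w p k (j + 1) + (v (j + 1))⁻¹)
    (d : ℕ) : ∀ j, 1 ≤ j → j + d = 2 * k - 1 →
      finCF (shiftedReverse (wWord p k (j + 1) (2 * k)) (v j)) =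
        w p k (2 * k) - v (2 * k - 1) ∧
        FinCFDefined (shiftedReverse (wWord p k (j + 1) (2 * k)) (v j)) := by
  induction d with
  | zero =>
    intro j h1 hj
    rw [wWord_succ (by omega), wWord_empty (by omega), show j + 1 = 2 * k by omega,
      show j = 2 * k - 1 by omega]
    exact ⟨finCF_singleton _, trivial⟩
  | succ d ih =>
    intro j h1 hj
    have e := ih (j + 1) (by omega) (by omega)
    have hsub : w p k (j + 1) - v j = -(v (j + 1))⁻¹ := by
      rw [hv j h1 (by omega)]
      ring
    have hne : w p k (j + 1) - v j ≠ 0 := by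
      rw [hsub]
      exact neg_ne_zero.2 (inv_ne_zero (hv0 _ (by omega) (by omega)))
    have hinv : w p k (j + 2) + (w p k (j + 1) - v j)⁻¹ = w p k (j + 2) - v (j + 1) := by
      rw [hsub, inv_neg, inv_inv, sub_eq_add_neg]
    rw [wWord_succ (n := j + 1 + 1) (by omega)] at e
    rw [wWord_succ (by omega), wWord_succ (n := j + 1 + 1) (by omega)]
    simp only [shiftedReverse, List.modifyHead_cons, List.reverse_cons, List.append_assoc,
      List.cons_append, List.nil_append] at e ⊢
    rwa [finCF_append_pair, finCFDefined_append_pair _ hne, hinv]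

/-- The value of `[w_{j+1}, ..., w_{2k}, ω_k]`. -/
def valA (p : ℕ) [Fact p.Prime] (k j : ℕ) : ZMod p :=
  (2 * k - j) * w p k (j + 1) / (2 * k - 2 * j - 1)

/-- The value of `[w_{j+1}, ..., w_{2k}]`. -/
def valB (p : ℕ) [Fact p.Prime] (k j : ℕ) : ZMod p :=
  -j * w p k (j + 1) / (2 * k - 2 * j - 1)

theorem valA_ne_zero (hp : p ≠ 2) (hk : 1 ≤ k) (hkp : 2 * k < p) {j : ℕ} (hj : 1 ≤ j)
    (hjk : j ≤ 2 * k - 1) : valA p k j ≠ 0 :=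
  div_ne_zero (mul_ne_zero (right_ne_zero_of_mul (mul_sub_ne_zero hkp hj (by omega)))
    (w_ne_zero hp hk hkp _ (by omega) (by omega))) (odd_ne_zero hkp (by omega))

theorem valB_ne_zero (hp : p ≠ 2) (hk : 1 ≤ k) (hkp : 2 * k < p) {j : ℕ} (hj : 1 ≤ j)
    (hjk : j ≤ 2 * k - 1) : valB p k j ≠ 0 :=
  div_ne_zero (mul_ne_zero (neg_ne_zero.2 (natCast_ne_zero_of_lt (by omega) (by omega)))
    (w_ne_zero hp hk hkp _ (by omega) (by omega))) (odd_ne_zero hkp (by omega))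

theorem valA_ne_valB (hp : p ≠ 2) (hk : 1 ≤ k) (hkp : 2 * k < p) {j : ℕ}
    (hjk : j ≤ 2 * k - 1) : valA p k j ≠ valB p k j := by
  have h2k := natCast_ne_zero_of_lt (p := p) (n := 2 * k) (by omega) hkp
  push_cast at h2k
  have : valA p k j - valB p k j = 2 * k * w p k (j + 1) / (2 * k - 2 * j - 1) := by
    rw [valA, valB]
    ring
  rw [← sub_ne_zero, this]
  exact div_ne_zero (mul_ne_zero h2k (w_ne_zero hp hk hkp _ (by omega) (by omega)))
    (odd_ne_zero hkp (by omega))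

/-- The product relation at j + 1 writes the inverse of the next value as a multiple of w_{j+1} over
the denominator 2k - 2j - 1. -/
theorem valA_rec (hp : p ≠ 2) (hk : 1 ≤ k) (hkp : 2 * k < p) {j : ℕ}
    (hjk : j < 2 * k - 1) : valA p k j = w p k (j + 1) + (valA p k (j + 1))⁻¹ := by
  have ha := odd_ne_zero (p := p) hkp (i := j) (by omega)
  have hb := odd_ne_zero (p := p) hkp (i := j + 1) (by omega)
  have h := w_mul hp hk hkp (j + 1) (by omega) (by omega)
  have hinv : (valA p k (j + 1))⁻¹ = w p k (j + 1) * (j + 1) / (2 * k - 2 * j - 1) := by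
    apply inv_eq_of_mul_eq_one_right
    rw [valA, div_mul_div_comm, div_eq_one_iff_eq (mul_ne_zero hb ha)]
    push_cast at h ⊢
    linear_combination h
  rw [hinv, valA, div_eq_iff ha, add_mul, div_mul_cancel₀ _ ha]
  ring

theorem valB_rec (hp : p ≠ 2) (hk : 1 ≤ k) (hkp : 2 * k < p) {j : ℕ}
    (hjk : j < 2 * k - 1) : valB p k j = w p k (j + 1) + (valB p k (j + 1))⁻¹ := by
  have ha := odd_ne_zero (p := p) hkp (i := j) (by omega)
  have hb := odd_ne_zero (p := p) hkp (i := j + 1) (by omega)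
  have h := w_mul hp hk hkp (j + 1) (by omega) (by omega)
  have hinv : (valB p k (j + 1))⁻¹ =
      -(w p k (j + 1) * (2 * k - j - 1)) / (2 * k - 2 * j - 1) := by
    apply inv_eq_of_mul_eq_one_right
    rw [valB, div_mul_div_comm, div_eq_one_iff_eq (mul_ne_zero hb ha)]
    push_cast at h ⊢
    linear_combination h
  rw [hinv, valB, div_eq_iff ha, add_mul, div_mul_cancel₀ _ ha]
  ring

theorem natCast_two_mul_sub_one (hk : 1 ≤ k) : ((2 * k - 1 : ℕ) : ZMod p) = 2 * k - 1 := by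
  push_cast [(by omega : 1 ≤ 2 * k)]
  rfl

theorem valB_top (hk : 1 ≤ k) (hkp : 2 * k < p) : valB p k (2 * k - 1) = w p k (2 * k) := by
  have h1 := two_mul_sub_one_ne_zero hk hkp
  rw [valB, natCast_two_mul_sub_one hk, show 2 * k - 1 + 1 = 2 * k by omega,
    show (2 * k - 2 * (2 * k - 1) - 1 : ZMod p) = -(2 * k - 1) by ring]
  field_simp

theorem valA_top (hp : p ≠ 2) (hk : 1 ≤ k) (hkp : 2 * k < p) :
    valA p k (2 * k - 1) = w p k (2 * k) + (omega p k)⁻¹ := by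
  have h1 := two_mul_sub_one_ne_zero hk hkp
  have h2 := omega_ne_zero hp hk hkp
  have h3 := natCast_ne_zero_of_lt (p := p) (n := 2 * k) (by omega) hkp
  push_cast at h3
  have hw : w p k (2 * k) = -((2 * k - 1) / (2 * k * omega p k)) := by
    rw [w_top hp hk hkp, w]
  rw [valA, natCast_two_mul_sub_one hk, show 2 * k - 1 + 1 = 2 * k by omega,
    show (2 * k - 2 * (2 * k - 1) - 1 : ZMod p) = -(2 * k - 1) by ring, hw]
  rw [← sub_eq_zero]
  have h4 : (k : ZMod p) ≠ 0 := right_ne_zero_of_mul h3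
  have h5 : (2 : ZMod p) ≠ 0 := left_ne_zero_of_mul h3
  field_simp
  ring

theorem finCF_wWord_omega (hp : p ≠ 2) (hk : 1 ≤ k) (hkp : 2 * k < p) {j : ℕ} (hj : 1 ≤ j)
    (hjk : j ≤ 2 * k - 1) : finCF (wWord p k (j + 1) (2 * k) ++ [omega p k]) = valA p k j ∧
      FinCFDefined (wWord p k (j + 1) (2 * k) ++ [omega p k]) := by
  refine finCF_wWord_append [omega p k] (valA p k) ?_ ?_
    (fun j h1 h2 => valA_ne_zero hp hk hkp h1 h2) (fun j _ h2 => valA_rec hp hk hkp h2)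
    (2 * k - 1 - j) j hj (by omega)
  · rw [finCF_cons, finCF_singleton, valA_top hp hk hkp]
  · refine ⟨trivial, ?_⟩
    rw [finCF_singleton]
    exact omega_ne_zero hp hk hkp

theorem finCF_wWord (hp : p ≠ 2) (hk : 1 ≤ k) (hkp : 2 * k < p) {j : ℕ} (hj : 1 ≤ j)
    (hjk : j ≤ 2 * k - 1) : finCF (wWord p k (j + 1) (2 * k)) = valB p k j ∧
      FinCFDefined (wWord p k (j + 1) (2 * k)) := by
  have := finCF_wWord_append [] (valB p k) (by rw [finCF_singleton, valB_top hk hkp]) trivial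
    (fun j h1 h2 => valB_ne_zero hp hk hkp h1 h2) (fun j _ h2 => valB_rec hp hk hkp h2)
    (2 * k - 1 - j) j hj (by omega)
  rwa [List.append_nil] at this

/-- The telescoped value is -1/ω_k, which is the required quotient because the two parameters are
opposite. -/
theorem condA_wWord (hp : p ≠ 2) (hk : 1 ≤ k) (hkp : 2 * k < p) {j : ℕ} (hj : 1 ≤ j)
    (hjk : j ≤ 2 * k - 1) {e : ZMod p} (he : e = -valA p k j) :
    CondA k (wWord p k (j + 1) (2 * k)) e (-e) := by
  have h0 := valA_ne_zero hp hk hkp hj hjk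
  have h1 := omega_ne_zero hp hk hkp
  obtain ⟨h2, h3⟩ := finCF_shiftedReverse (valA p k)
    (fun j h1 h2 => valA_ne_zero hp hk hkp h1 h2) (fun j _ h2 => valA_rec hp hk hkp h2)
    (2 * k - 1 - j) j hj (by omega)
  rw [he, neg_neg]
  refine ⟨h0, h3, ?_⟩
  rw [h2, valA_top hp hk hkp]
  field_simp
  ring

theorem condB_wWord (hp : p ≠ 2) (hk : 1 ≤ k) (hkp : 2 * k < p) {j : ℕ} (hj : 1 ≤ j)
    (hjk : j ≤ 2 * k - 1) {e : ZMod p} (he : e = -valB p k j) :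
    CondB (wWord p k (j + 1) (2 * k)) (-e) := by
  obtain ⟨h2, h3⟩ := finCF_shiftedReverse (valB p k)
    (fun j h1 h2 => valB_ne_zero hp hk hkp h1 h2) (fun j _ h2 => valB_rec hp hk hkp h2)
    (2 * k - 1 - j) j hj (by omega)
  rw [he, neg_neg]
  refine ⟨h3, ?_⟩
  rw [h2, valB_top hk hkp, sub_self]

theorem w_mul_reverse (hp : p ≠ 2) (hk : 1 ≤ k) (hkp : 2 * k < p) {j : ℕ} (hj : 1 ≤ j)
    (hjk : j ≤ 2 * k - 1) : (j * (2 * k - j) * w p k (j + 1) * w p k (2 * k - j + 1) : ZMod p) =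
      (2 * k - 2 * j - 1) * (2 * k - 2 * (2 * k - j : ℕ) - 1) := by
  have h := w_mul hp hk hkp j hj (by omega)
  rw [show 2 * k - j + 1 = 2 * k + 1 - j by omega, w_reverse hp hk hkp j hj (by omega)]
  push_cast [(by omega : j ≤ 2 * k)]
  linear_combination -h

/-- Hence 1/ε_A is the corresponding value for 2k - j, and β falls under the same lemma as α. -/
theorem valA_mul (hp : p ≠ 2) (hk : 1 ≤ k) (hkp : 2 * k < p) {j : ℕ} (hj : 1 ≤ j)
    (hjk : j ≤ 2 * k - 1) : valA p k j * valA p k (2 * k - j) = 1 := by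
  rw [valA, valA, div_mul_div_comm, div_eq_one_iff_eq (mul_ne_zero (odd_ne_zero hkp (by omega))
    (odd_ne_zero hkp (by omega))), ← w_mul_reverse hp hk hkp hj hjk]
  push_cast [(by omega : j ≤ 2 * k)]
  ring

theorem valB_mul (hp : p ≠ 2) (hk : 1 ≤ k) (hkp : 2 * k < p) {j : ℕ} (hj : 1 ≤ j)
    (hjk : j ≤ 2 * k - 1) : valB p k j * valB p k (2 * k - j) = 1 := by
  rw [valB, valB, div_mul_div_comm, div_eq_one_iff_eq (mul_ne_zero (odd_ne_zero hkp (by omega))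
    (odd_ne_zero hkp (by omega))), ← w_mul_reverse hp hk hkp hj hjk]
  push_cast [(by omega : j ≤ 2 * k)]
  ring

/-- Reversing the coefficients in X amounts to reversing the words in w: by `cont_w_reverse`,
x^(p+1) H_{j,ε}(1/x) = (-1)^(j-1) ε H_{2k-j,1/ε}(x). -/
theorem eval₂_H_inv (hp : p ≠ 2) (hk : 1 ≤ k) (hkp : 2 * k < p) {j : ℕ} (hj : 1 ≤ j)
    (hjk : j ≤ 2 * k - 1) {ε : ZMod p} (hε : ε ≠ 0) {x : (ZMod p)⸨X⸩} (hx : x ≠ 0)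
    (h : (H p k (2 * k - j) ε⁻¹).eval₂ polyEmb x = 0) : (H p k j ε).eval₂ polyEmb (1 / x) = 0 := by
  obtain ⟨i, rfl⟩ : ∃ i, j = i + 1 := ⟨j - 1, by omega⟩
  obtain ⟨l, hl⟩ : ∃ l, 2 * k = i + 1 + l + 1 := ⟨2 * k - i - 2, by omega⟩
  have e1 := cont_w_reverse hp hk hkp (n := l + 3) (m := 1) (l := i) (by omega) le_rfl (by omega)
  have e2 := cont_w_reverse hp hk hkp (n := l + 2) (m := 1) (l := i + 1) (by omega) le_rfl
    (by omega)
  have e3 := cont_w_reverse hp hk hkp (n := 1) (m := i + 2) (l := l + 1) le_rfl (by omega)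
    (by omega)
  have e4 := cont_w_reverse hp hk hkp (n := 1) (m := i + 3) (l := l) le_rfl (by omega)
    (by omega)
  rw [eval₂_H, K_eq_cont, K_eq_cont, K_eq_cont, K_eq_cont] at h ⊢
  rw [show 2 * k - (i + 1) + 2 = l + 3 by omega, show 2 * k + 2 - (l + 3) = i + 1 by omega,
    show 2 * k - (i + 1) + 1 = l + 2 by omega, show 2 * k + 2 - (l + 2) = i + 1 + 1 by omega,
    show l + 3 - 1 = l + 1 + 1 by omega, show 2 * k - (i + 1) - 1 + 2 - 1 = l + 1 by omega,
    e1, e2, e3, e4] at h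
  rw [show 2 * k + 2 - (i + 1 + 2) = l + 1 by omega,
    show 2 * k + 2 - (i + 1 + 1) = l + 1 + 1 by omega, show i + 1 + 2 - 1 = i + 1 + 1 by omega,
    show i + 1 - 1 + 2 - 1 = i + 1 by omega, show i + 1 + 2 = i + 3 by ring,
    show i + 1 + 1 = i + 2 by ring]
  have hs : ((-1) ^ l : (ZMod p)⸨X⸩) = (-1) ^ i := by
    have h1 : ((-1) ^ (i + l) : (ZMod p)⸨X⸩) = 1 := by
      rw [show i + l = 2 * (k - 1) by omega, pow_mul]; simp
    rw [pow_add] at h1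
    calc ((-1) ^ l : (ZMod p)⸨X⸩) = (-1) ^ i * (-1) ^ i * (-1) ^ l := by
          rw [← mul_pow]; simp
      _ = _ := by rw [mul_assoc, h1, mul_one]
  have hss : ((-1) ^ i * (-1) ^ i : (ZMod p)⸨X⸩) = 1 := by rw [← mul_pow]; simp
  have ht : polyEmb (Polynomial.C ε) * polyEmb (Polynomial.C ε⁻¹) = 1 := by
    rw [← map_mul, ← Polynomial.C_mul, mul_inv_cancel₀ hε, Polynomial.C_1, map_one]
  simp only [map_mul, map_pow, map_neg, map_one, pow_succ (-1 : (ZMod p)⸨X⸩), hs] at h ⊢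
  have hxi : x * (1 / x) = 1 := mul_one_div_cancel hx
  have hp1 : x ^ p * (1 / x) ^ p = 1 := by rw [← mul_pow, hxi, one_pow]
  apply (mul_eq_zero.1 (?_ : x ^ (p + 1) * _ = 0)).resolve_left (pow_ne_zero _ hx)
  set c := polyEmb (cont (w p k) (i + 3) (l + 1))
  set a := polyEmb (cont (w p k) (i + 2) (l + 1 + 1))
  set e := polyEmb (cont (w p k) 1 (i + 1 + 1))
  set g := polyEmb (cont (w p k) 1 (i + 1))
  set t := polyEmb (Polynomial.C ε)
  set t' := polyEmb (Polynomial.C ε⁻¹)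
  set z := 1 / x
  rw [pow_succ] at h ⊢
  rw [pow_succ]
  have goal' : c - a * x + t * e * x ^ p + t * g * (x ^ p * x) = 0 := by
    linear_combination t * (-1) ^ i * h + (-c + a * x) * ((-1) ^ i * (-1) ^ i * ht) +
      (-c + a * x) * hss - t * (g * (x ^ p * x) + e * x ^ p) * hss
  linear_combination goal' + c * (x ^ p * z ^ p) * hxi + c * hp1 - a * x * hp1 +
      t * e * x ^ p * hxi

end Perfect

/-! ### The case k = (p - 1)/2 and the quadratic series ρ. -/

section Rho

variable {p : ℕ} [Fact p.Prime] {k : ℕ}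

theorem two_ne_zero_of_ne_two (hp : p ≠ 2) : (2 : ZMod p) ≠ 0 := by
  have := natCast_ne_zero_of_lt (p := p) (n := 2) two_pos
    (lt_of_le_of_ne (Fact.out : p.Prime).two_le (Ne.symm hp))
  exact_mod_cast this

theorem exists_root_quadratic (hp : p ≠ 2) : ∃ ρ : (ZMod p)⸨X⸩, ρ.order < 0 ∧
    ρ ^ 2 + 2 * polyEmb Polynomial.X * ρ + 1 = 0 := by
  -- The exponent is taken to be 1 here, not the characteristic, so the equation is the quadratic
  -- itself.
  obtain ⟨x, hx⟩ := exists_unique_root (F := ZMod p) (A := Polynomial.C (-2) * Polynomial.X)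
    (C := 1) (E := 0) (G := 1) (p := 1) (n := 0) (m := 0) one_ne_zero
    (Polynomial.natDegree_C_mul_X _ (neg_ne_zero.2 (two_ne_zero_of_ne_two hp)))
    (by simp) one_ne_zero rfl (by simp) (by simp)
  obtain ⟨h1, h2⟩ := (hx x).2 rfl
  refine ⟨x, h1, ?_⟩
  simp only [map_mul, map_neg, map_ofNat, map_one, map_zero] at h2
  linear_combination h2

/-- Since 1/ρ = -ρ - 2T, one step of the expansion only changes the sign of ρ. -/
theorem neg_one_pow_mul_rho {ρ : (ZMod p)⸨X⸩}
    (h : ρ ^ 2 + 2 * polyEmb Polynomial.X * ρ + 1 = 0) (n : ℕ) :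
    (-1) ^ n * ρ = polyEmb (Polynomial.C ((-1) ^ (n + 1) * 2) * Polynomial.X) +
      ((-1) ^ (n + 1) * ρ)⁻¹ := by
  have hinv : ρ⁻¹ = -ρ - 2 * polyEmb Polynomial.X := by
    apply inv_eq_of_mul_eq_one_right
    linear_combination -h
  have hs : ((-1) ^ (n + 1) : (ZMod p)⸨X⸩)⁻¹ = (-1) ^ (n + 1) := by
    rw [← inv_pow, inv_neg, inv_one]
  rw [mul_inv, hs, hinv]
  simp only [map_mul, map_neg, map_pow, map_one, map_ofNat]
  ring

theorem order_neg_one_pow_mul {x : (ZMod p)⸨X⸩} (n : ℕ) : ((-1) ^ n * x).order = x.order := by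
  rcases neg_one_pow_eq_or (ZMod p)⸨X⸩ n with h | h <;> simp [h]

theorem isRho_of_root {ρ : (ZMod p)⸨X⸩} (hρ : ρ.order < 0)
    (h : ρ ^ 2 + 2 * polyEmb Polynomial.X * ρ + 1 = 0) : IsRho ρ := by
  have h0 := ne_zero_of_order_neg hρ
  have hpart : ∀ n : ℕ, polyPart ((-1) ^ n * ρ) =
      Polynomial.C ((-1) ^ (n + 1) * 2) * Polynomial.X := by
    intro n
    rw [neg_one_pow_mul_rho h, polyPart_add_of_small]
    intro m hm
    exact coeff_inv_of_order_neg (by rwa [order_neg_one_pow_mul]) hm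
  have hsub : ∀ n : ℕ, (-1) ^ n * ρ - polyEmb (polyPart ((-1) ^ n * ρ)) =
      ((-1) ^ (n + 1) * ρ)⁻¹ := by
    intro n
    rw [hpart]
    conv_lhs => rw [neg_one_pow_mul_rho h]
    ring
  have hcq : ∀ n, completeQuotient ρ n = (-1) ^ n * ρ := by
    intro n
    induction n with
    | zero => simp [completeQuotient]
    | succ n ih => rw [completeQuotient, ih, hsub, inv_inv]
  refine ⟨fun n => ?_, fun n => ?_⟩
  · rw [partialQuotient, hcq]
    refine ⟨?_, natDegree_polyPart_pos (by rwa [order_neg_one_pow_mul])⟩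
    rw [← sub_ne_zero, hsub]
    exact inv_ne_zero (mul_ne_zero (pow_ne_zero _ (by simp)) h0)
  · rw [partialQuotient, hcq, hpart]

theorem two_mul_cast_of_eq (hpk : 2 * k + 1 = p) : (2 * k : ZMod p) = -1 := by
  have : ((2 * k + 1 : ℕ) : ZMod p) = 0 := by rw [hpk, ZMod.natCast_self]
  push_cast at this
  linear_combination this

/-- Here 2k = -1 modulo p, so w_1 = 1/k = -2 and the product relation reads w_{i+1} w_i = -4. -/
theorem w_eq_of_half (hp : p ≠ 2) (hk : 1 ≤ k) (hpk : 2 * k + 1 = p) (i : ℕ) (h1 : 1 ≤ i)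
    (hi : i ≤ 2 * k) : w p k i = (-1) ^ i * 2 := by
  have hkp : 2 * k < p := by omega
  have h2k := two_mul_cast_of_eq hpk
  induction i, h1 using Nat.le_induction with
  | base =>
    have h := w_one_mul hp hk hkp
    obtain ⟨m, rfl⟩ : ∃ m, k = m + 1 := ⟨k - 1, by omega⟩
    rw [show (p - 1) / 2 = m + 1 by omega, Nat.add_sub_cancel,
      Nat.choose_succ_self_right] at h
    push_cast at h h2k ⊢
    linear_combination -2 * h + w p (m + 1) 1 * h2k
  | succ i h1 ih =>
    have h := w_mul hp hk hkp i h1 (by omega)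
    rw [ih (by omega), h2k] at h
    have hne := mul_sub_ne_zero hkp h1 (by omega : i < 2 * k)
    rw [h2k] at hne
    have hs : ((-1) ^ i * (-1) ^ i : ZMod p) = 1 := by rw [← mul_pow]; simp
    apply mul_right_cancel₀ hne
    apply mul_left_cancel₀ (two_ne_zero_of_ne_two hp)
    rw [pow_succ]
    linear_combination (-1) ^ i * h - 2 * w p k (i + 1) * (i * (-1 - i)) * hs

theorem valA_eq_of_half (hp : p ≠ 2) (hk : 1 ≤ k) (hpk : 2 * k + 1 = p) {j : ℕ}
    (hjk : j ≤ 2 * k - 1) : valA p k j = (-1) ^ (j + 1) := by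
  have h := odd_ne_zero (p := p) (k := k) (by omega) (i := j) (by omega)
  rw [valA, w_eq_of_half hp hk hpk _ (by omega) (by omega), div_eq_iff h,
    two_mul_cast_of_eq hpk]
  ring

/-- From (ρ + T)^2 = T^2 - 1, the power (ρ + T)^p equals both ρ^p + T^p and P_k(ρ + T), while T^p =
R_k + T P_k. -/
theorem rho_pow (hp : p ≠ 2) (hk : 1 ≤ k) (hpk : 2 * k + 1 = p) {ρ : (ZMod p)⸨X⸩}
    (h : ρ ^ 2 + 2 * polyEmb Polynomial.X * ρ + 1 = 0) :
    ρ ^ p = polyEmb (P p k) * ρ - polyEmb (R p k) := by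
  have : CharP (ZMod p)⸨X⸩ p := charP_of_injective_ringHom polyEmb_injective p
  have h1 : (ρ + polyEmb Polynomial.X) ^ p = ρ ^ p + polyEmb Polynomial.X ^ p :=
    add_pow_char _ _ _
  have h2 : (ρ + polyEmb Polynomial.X) ^ 2 = polyEmb (Polynomial.X ^ 2 - 1) := by
    rw [map_sub, map_pow, map_one]
    linear_combination h
  have h3 : (ρ + polyEmb Polynomial.X) ^ p =
      polyEmb (P p k) * (ρ + polyEmb Polynomial.X) := by
    calc _ = (ρ + polyEmb Polynomial.X) ^ (2 * k + 1) := by rw [hpk]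
      _ = _ := by rw [pow_succ, pow_mul, h2, P, map_pow]
  have h4 : (Polynomial.X ^ p : (ZMod p)[X]) = R p k + Polynomial.X * P p k := by
    rw [X_pow_eq_binomialSum hp, show (p - 1) / 2 + 1 = k + 1 by omega, binomialSum_succ,
      ← R_eq hp hk (by omega), show (p - 1) / 2 = k by omega, Nat.choose_self, P]
    simp
  have h5 := congrArg polyEmb h4
  rw [map_pow, map_add, map_mul] at h5
  linear_combination h3 - h1 - h5

theorem cfEval_wWord_rho (hp : p ≠ 2) (hk : 1 ≤ k) (hpk : 2 * k + 1 = p) {ρ : (ZMod p)⸨X⸩}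
    (h : ρ ^ 2 + 2 * polyEmb Polynomial.X * ρ + 1 = 0) (d : ℕ) : ∀ n,
    n + d = 2 * k → cfEval (wWord p k (n + 1) (2 * k)) ρ = (-1) ^ n * ρ := by
  induction d with
  | zero =>
    intro n hn
    rw [wWord_empty (by omega), cfEval_nil, show n = 2 * k by omega, pow_mul]
    simp
  | succ d ih =>
    intro n hn
    rw [wWord_succ (by omega), cfEval_cons, ih (n + 1) (by omega),
      w_eq_of_half hp hk hpk _ (by omega) (by omega), ← neg_one_pow_mul_rho h]

theorem eval₂_H_rho (hp : p ≠ 2) (hk : 1 ≤ k) (hpk : 2 * k + 1 = p) {j : ℕ} (hj : 1 ≤ j)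
    (hjk : j ≤ 2 * k - 1) {ε : ZMod p} (hε : ε * (-1) ^ (k + j) = (-1) ^ j) {ρ : (ZMod p)⸨X⸩}
    (hρ : ρ.order < 0) (h : ρ ^ 2 + 2 * polyEmb Polynomial.X * ρ + 1 = 0) :
    (H p k j ε).eval₂ polyEmb ((-1) ^ j * ρ) = 0 := by
  have hcf := cfEval_wWord hp hk (by omega) hj hjk hρ
  rw [cfEval_wWord_rho hp hk hpk h (2 * k - j) j (by omega)] at hcf
  rw [(eval₂_H_eq_zero_iff hp hk (by omega) hj hjk ε hcf).2, hε, mul_pow, rho_pow hp hk hpk h,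
    ← pow_mul, mul_comm j p, pow_mul, Odd.neg_one_pow ⟨k, hpk.symm⟩]
  simp only [map_mul, map_neg, map_pow, map_one]
  ring

theorem eval₂_quadratic (j : ℕ) (x : (ZMod p)⸨X⸩) : (quadratic p j).eval₂ polyEmb x =
    x ^ 2 + 2 * (-1) ^ j * polyEmb Polynomial.X * x + 1 := by
  rw [quadratic, Polynomial.eval₂_add, Polynomial.eval₂_add, Polynomial.eval₂_mul,
    Polynomial.eval₂_X_pow, Polynomial.eval₂_X, Polynomial.eval₂_C, Polynomial.eval₂_one]
  simp only [map_mul, map_pow, map_neg, map_one, map_ofNat]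

theorem monic_quadratic (j : ℕ) : (quadratic p j).Monic := by
  rw [quadratic]
  monicity!

theorem natDegree_quadratic (j : ℕ) : (quadratic p j).natDegree = 2 := by
  rw [quadratic]
  compute_degree!

/-- The remainder modulo the monic quadratic is a X + b with a x + b = 0, which is trivial for
irrational x. -/
theorem quadratic_dvd {j : ℕ} {f : (ZMod p)[X][X]} {x : (ZMod p)⸨X⸩} (hx : ¬ IsRational x)
    (hq : (quadratic p j).eval₂ polyEmb x = 0) (hf : f.eval₂ polyEmb x = 0) :
    quadratic p j ∣ f := by
  rw [← Polynomial.modByMonic_eq_zero_iff_dvd (monic_quadratic j)]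
  have hr : (f %ₘ quadratic p j).eval₂ polyEmb x = 0 := by
    rw [Polynomial.modByMonic_eq_sub_mul_div _ (quadratic p j), Polynomial.eval₂_sub,
      Polynomial.eval₂_mul, hq, hf]
    simp
  have hdeg : (f %ₘ quadratic p j).natDegree < 2 := by
    rw [← natDegree_quadratic (p := p) j]
    apply Polynomial.natDegree_modByMonic_lt _ (monic_quadratic j)
    intro h1
    have := natDegree_quadratic (p := p) j
    rw [h1, Polynomial.natDegree_one] at this
    omega
  obtain ⟨a, b, hab⟩ := Polynomial.exists_eq_X_add_C_of_natDegree_le_one (by omega :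
    (f %ₘ quadratic p j).natDegree ≤ 1)
  rw [hab] at hr ⊢
  simp only [Polynomial.eval₂_add, Polynomial.eval₂_mul, Polynomial.eval₂_C,
    Polynomial.eval₂_X] at hr
  have ha : a = 0 := by
    by_contra ha
    refine hx ⟨-b, a, ha, ?_⟩
    rw [map_neg]
    linear_combination hr
  have hb : b = 0 := by
    rw [ha, map_zero, zero_mul, zero_add] at hr
    exact (map_eq_zero_iff _ polyEmb_injective).1 hr
  simp [ha, hb]

end Rho

end

end PkCF

theorem proposition5p1 (p : ℕ) [Fact p.Prime] (hp : p ≠ 2) (k : ℕ) (hk : 1 ≤ k) (hkp : 2 * k < p)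
    (j : ℕ) (hj : 1 ≤ j) (hjk : j ≤ 2 * k - 1) :
    -- the two values of `ε` are well defined, non-zero and different
    PkCF.FinCFDefined (PkCF.wWord p k (j + 1) (2 * k) ++ [PkCF.omega p k]) ∧
    PkCF.FinCFDefined (PkCF.wWord p k (j + 1) (2 * k)) ∧
    PkCF.epsA p k j ≠ 0 ∧ PkCF.epsB p k j ≠ 0 ∧ PkCF.epsA p k j ≠ PkCF.epsB p k j ∧
    ∀ ε : ZMod p, ε ≠ 0 →
      ∃ α β : LaurentSeries (ZMod p),
        -- `α` is the unique expansion `[w_{j+1} T, ..., w_{2k} T, α_{2k-j+1}]` with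
        -- `α ^ p = ε (-1) ^ (k + j) (P_k α_{2k-j+1} - R_k)`
        (∀ x, PkCF.IsPkExpansion k (PkCF.wWord p k (j + 1) (2 * k))
          (ε * (-1) ^ (k + j)) (-(ε * (-1) ^ (k + j))) x ↔ x = α) ∧
        -- `β` is the unique expansion `[w_{2k-j+1} T, ..., w_{2k} T, β_{j+1}]` with
        -- `β ^ p = ε⁻¹ (-1) ^ (k + j) (P_k β_{j+1} - R_k)`
        (∀ x, PkCF.IsPkExpansion k (PkCF.wWord p k (2 * k - j + 1) (2 * k))
          (ε⁻¹ * (-1) ^ (k + j)) (-(ε⁻¹ * (-1) ^ (k + j))) x ↔ x = β) ∧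
        (PkCF.H p k j ε).eval₂ PkCF.polyEmb α = 0 ∧
        (PkCF.H p k j ε).eval₂ PkCF.polyEmb (1 / β) = 0 ∧
        (ε = PkCF.epsA p k j →
          PkCF.CondA k (PkCF.wWord p k (j + 1) (2 * k))
            (ε * (-1) ^ (k + j)) (-(ε * (-1) ^ (k + j))) ∧
          PkCF.CondA k (PkCF.wWord p k (2 * k - j + 1) (2 * k))
            (ε⁻¹ * (-1) ^ (k + j)) (-(ε⁻¹ * (-1) ^ (k + j)))) ∧
        (ε = PkCF.epsB p k j →
          PkCF.CondB (PkCF.wWord p k (j + 1) (2 * k)) (-(ε * (-1) ^ (k + j))) ∧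
          PkCF.CondB (PkCF.wWord p k (2 * k - j + 1) (2 * k)) (-(ε⁻¹ * (-1) ^ (k + j)))) ∧
        (k = (p - 1) / 2 → ε = PkCF.epsA p k j →
          (∃ ρ, PkCF.IsRho ρ ∧ α = (-1) ^ j * ρ) ∧
          (PkCF.quadratic p j).eval₂ PkCF.polyEmb α = 0 ∧
          PkCF.quadratic p j ∣ PkCF.H p k j ε) := by
  have hA := PkCF.finCF_wWord_omega hp hk hkp hj hjk
  have hB := PkCF.finCF_wWord hp hk hkp hj hjk
  have hA0 := PkCF.valA_ne_zero hp hk hkp hj hjk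
  have hB0 := PkCF.valB_ne_zero hp hk hkp hj hjk
  have hs : ∀ n : ℕ, ((-1) ^ n : ZMod p) ≠ 0 := fun n => pow_ne_zero _ (by simp)
  have hss : ∀ n : ℕ, ((-1) ^ n * (-1) ^ n : ZMod p) = 1 := fun n => by rw [← mul_pow]; simp
  have hsi : ∀ n : ℕ, ((-1) ^ n : ZMod p)⁻¹ = (-1) ^ n := fun n =>
    inv_eq_of_mul_eq_one_right (hss n)
  have heA : PkCF.epsA p k j = (-1) ^ (k + j + 1) * PkCF.valA p k j := by rw [PkCF.epsA, hA.1]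
  have heB : PkCF.epsB p k j = (-1) ^ (k + j + 1) * PkCF.valB p k j := by rw [PkCF.epsB, hB.1]
  have hsign : ∀ v : ZMod p, (-1) ^ (k + j + 1) * v * (-1) ^ (k + j) = -v := fun v => by
    rw [pow_succ]
    linear_combination -v * hss (k + j)
  have hsign' : ∀ v v' : ZMod p, v * v' = 1 →
      ((-1) ^ (k + j + 1) * v)⁻¹ * (-1) ^ (k + j) = -v' := fun v v' hv => by
    rw [mul_inv, hsi, inv_eq_of_mul_eq_one_right hv, hsign]
  refine ⟨hA.2, hB.2, ?_, ?_, ?_, ?_⟩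
  · rw [heA]
    exact mul_ne_zero (hs _) hA0
  · rw [heB]
    exact mul_ne_zero (hs _) hB0
  · rw [heA, heB]
    exact fun h => PkCF.valA_ne_valB hp hk hkp hjk (mul_left_cancel₀ (hs _) h)
  intro ε hε
  have hj' : 1 ≤ 2 * k - j := by omega
  have hjk' : 2 * k - j ≤ 2 * k - 1 := by omega
  obtain ⟨α, hα⟩ := PkCF.exists_unique_root_H hp hk hkp hj hjk ε
  obtain ⟨β, hβ⟩ := PkCF.exists_unique_root_H hp hk hkp hj' hjk' ε⁻¹
  have hα' := fun x => (PkCF.isPkExpansion_iff hp hk hkp hj hjk hε x).trans (hα x)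
  -- The series β is the root attached to (2k - j, 1/ε); the parity makes its sign the one in the
  -- statement.
  have hpar : ((-1) ^ (k + (2 * k - j)) : ZMod p) = (-1) ^ (k + j) := by
    have h1 : (-1 : ZMod p) ^ (k + (2 * k - j)) * (-1) ^ (k + j) = 1 := by
      rw [← pow_add, show k + (2 * k - j) + (k + j) = 2 * (2 * k) by omega, pow_mul]
      simp
    linear_combination (-1) ^ (k + j) * h1 - (-1) ^ (k + (2 * k - j)) * hss (k + j)
  have hβ' := fun x =>
    (PkCF.isPkExpansion_iff hp hk hkp hj' hjk' (inv_ne_zero hε) x).trans (hβ x)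
  rw [hpar] at hβ'
  have hαr := (hα α).2 rfl
  have hβr := (hβ β).2 rfl
  refine ⟨α, β, hα', hβ', hαr.2,
    PkCF.eval₂_H_inv hp hk hkp hj hjk hε (PkCF.ne_zero_of_order_neg hβr.1) hβr.2, ?_, ?_, ?_⟩
  · rintro rfl
    rw [heA]
    exact ⟨PkCF.condA_wWord hp hk hkp hj hjk (hsign _),
      PkCF.condA_wWord hp hk hkp hj' hjk' (hsign' _ _ (PkCF.valA_mul hp hk hkp hj hjk))⟩
  · rintro rfl
    rw [heB]
    exact ⟨PkCF.condB_wWord hp hk hkp hj hjk (hsign _),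
      PkCF.condB_wWord hp hk hkp hj' hjk' (hsign' _ _ (PkCF.valB_mul hp hk hkp hj hjk))⟩
  · intro hkhalf hεA
    have hpk : 2 * k + 1 = p := by rw [hkhalf, PkCF.two_mul_half hp]
    obtain ⟨ρ, hρ, hρ2⟩ := PkCF.exists_root_quadratic hp
    have hε' : ε * (-1) ^ (k + j) = (-1) ^ j := by
      rw [hεA, heA, hsign, PkCF.valA_eq_of_half hp hk hpk hjk, pow_succ]
      ring
    -- Uniqueness of the root of positive degree identifies the two series, without comparing
    -- partial quotients.
    have hαρ : (-1) ^ j * ρ = α := (hα _).1 ⟨by rwa [PkCF.order_neg_one_pow_mul],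
      PkCF.eval₂_H_rho hp hk hpk hj hjk hε' hρ hρ2⟩
    have hq : (PkCF.quadratic p j).eval₂ PkCF.polyEmb α = 0 := by
      have hs2 : ((-1) ^ j * (-1) ^ j : LaurentSeries (ZMod p)) = 1 := by rw [← mul_pow]; simp
      rw [PkCF.eval₂_quadratic, ← hαρ]
      linear_combination hρ2 + (ρ ^ 2 + 2 * PkCF.polyEmb Polynomial.X * ρ) * hs2
    exact ⟨⟨ρ, PkCF.isRho_of_root hρ hρ2, hαρ.symm⟩, hq,
      PkCF.quadratic_dvd ((hα' α).2 rfl).infinite.not_isRational hq hαr.2⟩
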